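/- Let $E_n$ be a Euclidean space of dimension $n\ge 1$ with scalar product $\langle\cdot,\cdot\rangle$, and let $R\subset E_n$ be a reduced irreducible crystallographic root system spanning $E_n$, with simple roots $\alpha_1,\dots,\alpha_n$, coroots $\alpha^\vee=2\alpha/\langle\alpha,\alpha\rangle$, highest root $\xi$ and Weyl group $W$ generated by the reflections $r_{\alpha_i}$. Let $W_e=\{w\in W:\det w=1\}$, let $Q^\vee=\bigoplus_i\mathbb Z\alpha_i^\vee$, and let $W_e^{\rm aff}$ be the group generated by $W_e$ and the translations by elements of $Q^\vee$. Fix a root $\alpha$. Let $P=\{\lambda\in E_n:\langle\alpha_i^\vee,\lambda\rangle\in\mathbb Z\text{ for all }i\}$, let $P_+$ (resp. $P_+^+$) be the set of $\lambda\in P$ with $\langle\lambda,\alpha_i\rangle\ge 0$ (resp. $>0$) for all $i$, and put $$P^e_+=P_+\cup r_\alpha P_+^+ .$$ Let $F$ be the interior of the simplex $\{x:\langle x,\alpha_i\rangle\ge0\ (1\le i\le n),\ \langle x,\xi\rangle\le 1\}$, and let $F_e$ be the set $\overline F\cup r_\alpha\overline F$ without its boundary. Let $dx$ be the Euclidean measure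 on $E_n$ normalized so that the torus $E_n/Q^\vee$ (the parallelepiped spanned by $\alpha_1^\vee,\dots,\alpha_n^\vee$) has measure $1$. For $\lambda\in P^e_+$ let $O_e(\lambda)$ be the $W_e$-orbit of $\lambda$, let $W_\lambda=\{w\in W_e:w\lambda=\lambda\}$, and put $$E_\lambda(x)=\sum_{\mu\in O_e(\lambda)}e^{2\pi i\langle\mu,x\rangle},\qquad \hat E_\lambda(x)=\sum_{w\in W_e}e^{2\pi i\langle w\lambda,x\rangle}.$$ (1) Let $f$ be a complex-valued function that is square-integrable on $\overline{F_e}$ and $W_e^{\rm aff}$-invariant there (that is, $f(gx)=f(x)$ whenever $g\in W_e^{\rm aff}$ and $x,gx\in\overline{F_e}$). Then, with $$c_\lambda=\int_{\overline{F_e}}f(x)\hat E_\lambda(x)\,dx=|W_\lambda|\int_{\overline{F_e}}f(x)E_\lambda(x)\,dx\qquad(\lambda\in P^e_+)$$ (the integrals converge absolutely and the two expressions agree), one has $$f=\sum_{\lambda\in P^e_+}c_\lambda\,\overline{E_\lambda}$$ with unconditional convergence in $L^2(\overline{F_e},dx)$, and the Plancherel formula $$\int_{\overline{F_e}}|f(x)|^2dx=\sum_{\lambda\in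 P^e_+}|W_\lambda|^{-1}|c_\lambda|^2 .$$ (2) The functions $E_\lambda$, $\lambda\in P^e_+$, form an orthogonal basis of the Hilbert space $\mathcal L^2(F_e)=L^2(\overline{F_e},dx)$: they are square-integrable, nonzero, pairwise orthogonal, and their linear span is dense. -/

import Mathlib

open MeasureTheory Filter Topology
open scoped InnerProductSpace ComplexConjugate ENNReal

namespace EOrbit

noncomputable section

/-- A root system whose roots and coroots both lie in the Euclidean space `E`: the pairing is the
scalar product and the coroots are `α^∨ = 2α / ⟨α, α⟩`. -/
structure IsEuclidean {ι E : Type*} [NormedAddCommGroup E] [InnerProductSpace ℝ E]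
    (R : RootPairing ι ℝ E E) : Prop where
  pairing_eq_inner : ∀ x y : E, R.toLinearMap x y = ⟪x, y⟫_ℝ
  coroot_eq : ∀ i : ι, R.coroot i = (2 / ⟪R.root i, R.root i⟫_ℝ) • R.root i

/-- The root with index `θ` is the highest root `ξ`: for every root `β`, the difference `ξ - β`
is a linear combination of simple roots with nonnegative integer coefficients. -/
def IsHighestRoot {ι E : Type*} [AddCommGroup E] [Module ℝ E] {R : RootPairing ι ℝ E E}
    (b : R.Base) (θ : ι) : Prop :=
  ∀ i : ι, R.root θ - R.root i ∈ AddSubmonoid.closure (R.root '' (b.support : Set ι))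

variable {ι E : Type*} [NormedAddCommGroup E] [InnerProductSpace ℝ E] {R : RootPairing ι ℝ E E}

/-- The Weyl group `W`, generated by the reflections in the simple roots. -/
def weylGroup (b : R.Base) : Subgroup (E ≃ₗ[ℝ] E) :=
  Subgroup.closure (R.reflection '' (b.support : Set ι))

/-- The even Weyl group `W_e = {w ∈ W : det w = 1}`. -/
def evenWeylGroup (b : R.Base) : Subgroup (E ≃ₗ[ℝ] E) :=
  weylGroup b ⊓ (LinearEquiv.det : (E ≃ₗ[ℝ] E) →* ℝˣ).ker

/-- The coroot lattice `Q^∨`. -/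
def corootLattice (b : R.Base) : AddSubgroup E :=
  AddSubgroup.closure (R.coroot '' (b.support : Set ι))

/-- The even affine Weyl group `W_e^aff`, generated by `W_e` and the translations by elements of
the coroot lattice. -/
def evenAffineWeylGroup (b : R.Base) : Subgroup (E ≃ᵃ[ℝ] E) :=
  Subgroup.closure
    ({g | ∃ w ∈ evenWeylGroup b, g = w.toAffineEquiv} ∪
      {g | ∃ ν ∈ corootLattice b, g = AffineEquiv.constVAdd ℝ E ν})

/-- The closed dominant Weyl chamber `D_+`. -/
def dominantChamber (b : R.Base) : Set E :=
  {x | ∀ i ∈ b.support, 0 ≤ ⟪x, R.root i⟫_ℝ}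

/-- The weight lattice `P`. -/
def weightLattice (b : R.Base) : Set E :=
  {l | ∀ i ∈ b.support, ∃ m : ℤ, ⟪R.coroot i, l⟫_ℝ = m}

/-- The dominant integral weights `P_+`. -/
def dominantWeights (b : R.Base) : Set E :=
  weightLattice b ∩ dominantChamber b

/-- The strictly dominant integral weights `P_+^+`. -/
def strictlyDominantWeights (b : R.Base) : Set E :=
  weightLattice b ∩ {x | ∀ i ∈ b.support, 0 < ⟪x, R.root i⟫_ℝ}

/-- The set `P^e_+` of weights in the even dominant chamber `D_+ ∪ r_α D_+`, where `α` is the root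
with index `a`. Only the strictly dominant weights are reflected: for `l` on a wall of `D_+`, the
point `r_α l` lies in the same `W_e`-orbit as `l`, and each orbit is to be counted once. -/
def evenDominantWeights (b : R.Base) (a : ι) : Set E :=
  dominantWeights b ∪ R.reflection a '' strictlyDominantWeights b

/-- The fundamental domain `F` of the affine Weyl group: the interior of the simplex
`{x ∈ D_+ : ⟨x, ξ⟩ ≤ 1}`, where `ξ` is the highest root, with index `θ`. -/
def affineDomain (b : R.Base) (θ : ι) : Set E :=
  interior {x | x ∈ dominantChamber b ∧ ⟪x, R.root θ⟫_ℝ ≤ 1}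

/-- The fundamental domain `F_e` of the even affine Weyl group: the union of the closure of `F`
and its mirror image under `r_α`, without its boundary. -/
def evenAffineDomain (b : R.Base) (θ a : ι) : Set E :=
  (closure (affineDomain b θ) ∪ R.reflection a '' closure (affineDomain b θ)) \
    frontier (closure (affineDomain b θ) ∪ R.reflection a '' closure (affineDomain b θ))

/-- The Euclidean measure `dx`, normalized so that the torus `E / Q^∨`, that is, the
parallelepiped spanned by the simple coroots, has measure one. -/
def torusMeasure [MeasurableSpace E] [BorelSpace E] [R.IsRootSystem] (b : R.Base) : Measure E :=
  b.toCoweightBasis.addHaar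

/-- The normalized measure restricted to the closure of `F_e`. -/
def domainMeasure [MeasurableSpace E] [BorelSpace E] [R.IsRootSystem] (b : R.Base) (θ a : ι) :
    Measure E :=
  (torusMeasure b).restrict (closure (evenAffineDomain b θ a))

/-- The even orbit `O_e(l)`. -/
def evenOrbit (b : R.Base) (l : E) : Set E :=
  MulAction.orbit (evenWeylGroup b) l

/-- The order of the subgroup of `W_e` whose elements fix `l`. -/
def stabCard (b : R.Base) (l : E) : ℕ :=
  Nat.card (MulAction.stabilizer (evenWeylGroup b) l)

/-- The `E`-orbit function `E_l(x)`, a sum over the finite orbit `O_e(l)`. -/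
def orbitFunction (b : R.Base) (l x : E) : ℂ :=
  ∑ᶠ m ∈ evenOrbit b l, Complex.exp (2 * Real.pi * Complex.I * (⟪m, x⟫_ℝ : ℂ))

/-- The normalized `E`-orbit function `Ê_l(x)`, a sum over the finite group `W_e`. -/
def normalizedOrbitFunction (b : R.Base) (l x : E) : ℂ :=
  ∑ᶠ w : evenWeylGroup b,
    Complex.exp (2 * Real.pi * Complex.I * (⟪(w : E ≃ₗ[ℝ] E) l, x⟫_ℝ : ℂ))

/-- The coefficient `c_l = |W_l| ∫ f E_l dx`, the integral being over the closure of `F_e`. -/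
def transformCoeff [MeasurableSpace E] [BorelSpace E] [R.IsRootSystem] (b : R.Base) (θ a : ι)
    (f : E → ℂ) (l : E) : ℂ :=
  (stabCard b l : ℂ) * ∫ x, f x * orbitFunction b l x ∂(domainMeasure b θ a)

/-- An orthogonal basis of a Hilbert space: nonzero, pairwise orthogonal vectors whose linear
span is dense. -/
structure IsOrthogonalBasis {κ H : Type*} [NormedAddCommGroup H] [InnerProductSpace ℂ H]
    (v : κ → H) : Prop where
  ne_zero : ∀ k, v k ≠ 0
  orthogonal : ∀ k l, k ≠ l → ⟪v k, v l⟫_ℂ = 0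
  dense_span : (Submodule.span ℂ (Set.range v)).topologicalClosure = ⊤

/-- The Weyl group is finite, so the sums above are finite. -/
theorem finite_weylGroup [Finite ι] [R.IsRootSystem] (b : R.Base) : Finite (weylGroup b) := by
  have key : ∀ w : weylGroup b, ∀ i, ∃ j, (w : E ≃ₗ[ℝ] E) (R.root i) = R.root j := by
    rintro ⟨w, hw⟩
    induction hw using Subgroup.closure_induction'' with
    | one => exact fun i => ⟨i, rfl⟩
    | mem x hx =>
      obtain ⟨k, -, rfl⟩ := hx
      exact fun i => ⟨R.reflectionPerm k i, (R.root_reflectionPerm k i).symm⟩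
    | inv_mem x hx =>
      obtain ⟨k, -, rfl⟩ := hx
      refine fun i => ⟨R.reflectionPerm k i, ?_⟩
      rw [R.root_reflectionPerm k i]
      exact congrArg (fun e : E ≃ₗ[ℝ] E => e (R.root i)) (R.reflection_inv k)
    | mul x y _ _ hx hy =>
      intro i
      obtain ⟨j, hj⟩ := hy i
      obtain ⟨k, hk⟩ := hx j
      refine ⟨k, ?_⟩
      change x (y (R.root i)) = _
      exact (congrArg x hj).trans hk
  choose p hp using key
  refine Finite.of_injective p fun w w' h => ?_
  apply Subtype.ext
  apply LinearEquiv.toLinearMap_injective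
  refine LinearMap.ext_on_range (v := R.root) RootPairing.IsRootSystem.span_root_eq_top fun i => ?_
  have h1 := hp w i
  have h2 := hp w' i
  rw [h] at h1
  exact h1.trans h2.symm

end

end EOrbit

namespace EOrbit

variable {ι E : Type*} [NormedAddCommGroup E] [InnerProductSpace ℝ E] {R : RootPairing ι ℝ E E}

/-! ### Reflections of a Euclidean root system -/

/-! The geometry reduces to the box `rootBox R` on which every root has absolute value at most 1. It
is invariant under the Weyl group, and its dominant part is the closed alcove (`closedAlcove_eq`).
Hence the even Weyl group tiles the box, up to walls, by copies of the closure of `F_e`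
(`rootBox_eq_iUnion`, `even_eq_one_of_regular`). The box is also a fundamental domain for the coroot
lattice (`isAddFundamentalDomain_rootBox`), so it has measure one. Thus Fourier analysis on the
torus can be carried out on the box and folded onto `F_e`, without a structure theory of the affine
Weyl group.

Orthogonality: the integral of `Ê_l` over `F_e` unfolds to the integral of one exponential over the
box, which is 1 or 0. The product of `Ê_l` with the conjugate of `Ê_m` is the sum of the functions
`Ê_{l - u m}` over `u` in `W_e`, so its integral counts the `u` with `u m = l`. The set `P^e_+`
meets each `W_e`-orbit of weights exactly once, which leaves only the diagonal and the stabilizer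
order.

Completeness: if a real integrable function on `F_e` is annihilated by all `Ê_l`, its positive and
negative parts are densities of two finite measures with equal `Ê_l`-integrals. Summing the
push-forwards of such a measure to the torus over `W_e` turns these integrals into Fourier
coefficients, which determine the sum. On regular points nothing is identified, so the original
measure is recovered (`measure_ext_normalizedOrbitFunction`). Hilbert space theory then gives the
expansion and the Plancherel formula (`hasSum_of_orthogonal_complete`). -/

theorem inner_root_self_pos (R : RootPairing ι ℝ E E) (i : ι) :
    0 < ⟪R.root i, R.root i⟫_ℝ :=
  real_inner_self_pos.2 (R.ne_zero i)

theorem IsEuclidean.reflection_apply (hR : IsEuclidean R) (i : ι) (x : E) :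
    R.reflection i x = x - ⟪x, R.coroot i⟫_ℝ • R.root i := by
  rw [RootPairing.reflection_apply, ← hR.pairing_eq_inner]
  rfl

theorem IsEuclidean.reflection_apply' (hR : IsEuclidean R) (i : ι) (x : E) :
    R.reflection i x = x - ⟪x, R.root i⟫_ℝ • R.coroot i := by
  rw [hR.reflection_apply, hR.coroot_eq, inner_smul_right, smul_smul, mul_comm]

theorem IsEuclidean.inner_reflection (hR : IsEuclidean R) (i : ι) (x y : E) :
    ⟪R.reflection i x, R.reflection i y⟫_ℝ = ⟪x, y⟫_ℝ := by
  have h := (inner_root_self_pos R i).ne'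
  rw [hR.reflection_apply, hR.reflection_apply, hR.coroot_eq]
  simp only [inner_sub_left, inner_sub_right, inner_smul_left, inner_smul_right,
    RCLike.conj_to_real]
  rw [real_inner_comm (R.root i) x, real_inner_comm y (R.root i)]
  field_simp
  ring

theorem IsEuclidean.inner_root_coroot (hR : IsEuclidean R) (i j : ι) :
    ⟪R.root i, R.coroot j⟫_ℝ = R.pairing i j :=
  (hR.pairing_eq_inner _ _).symm

theorem det_reflection [FiniteDimensional ℝ E] (R : RootPairing ι ℝ E E) (i : ι) :
    LinearEquiv.det (R.reflection i) = -1 := by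
  -- A reflection has the algebraic shape of a transvection, so its determinant is one plus the
  -- functional evaluated at the vector: 1 - 2.
  have h : ((R.reflection i : E ≃ₗ[ℝ] E) : E →ₗ[ℝ] E) =
      LinearMap.transvection (-(R.coroot' i)) (R.root i) := by
    ext x
    simp [RootPairing.reflection_apply, LinearMap.transvection.apply, sub_eq_add_neg]
  apply Units.ext
  rw [LinearEquiv.coe_det, h, LinearMap.transvection.det]
  have := R.root_coroot_two i
  simp only [LinearMap.neg_apply, Units.val_neg, Units.val_one]
  have h2 : R.coroot' i (R.root i) = 2 := this
  rw [h2]; norm_num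

/-! ### The Weyl group -/

theorem simple_reflection_mem (b : R.Base) {i : ι} (hi : i ∈ b.support) :
    R.reflection i ∈ weylGroup b :=
  Subgroup.subset_closure ⟨i, hi, rfl⟩

/-- Every root is obtained from a simple one by simple reflections, and its reflection is the
corresponding conjugate. This is needed because `α` is an arbitrary root. -/
theorem reflection_mem_weylGroup [Finite ι] [R.IsCrystallographic] [R.IsReduced]
    (b : R.Base) (i : ι) : R.reflection i ∈ weylGroup b := by
  refine b.induction_reflect i (p := fun i => R.reflection i ∈ weylGroup b) ?_ ?_ ?_
  · intro i hi
    rw [RootPairing.reflection_reflectionPerm]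
    exact mul_mem (mul_mem hi hi) hi
  · exact fun i hi => simple_reflection_mem b hi
  · intro i j hi hj
    rw [RootPairing.reflection_reflectionPerm]
    have := simple_reflection_mem b hj
    exact mul_mem (mul_mem this hi) this

theorem exists_word (b : R.Base) {w : E ≃ₗ[ℝ] E} (hw : w ∈ weylGroup b) :
    ∃ l : List ι, (∀ j ∈ l, j ∈ b.support) ∧ (l.map R.reflection).prod = w := by
  induction hw using Subgroup.closure_induction'' with
  | one => exact ⟨[], by simp, by simp⟩
  | mem x hx =>
    obtain ⟨k, hk, rfl⟩ := hx
    exact ⟨[k], by simpa using hk, by simp⟩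
  | inv_mem x hx =>
    obtain ⟨k, hk, rfl⟩ := hx
    exact ⟨[k], by simpa using hk, by simp⟩
  | mul x y _ _ hx hy =>
    obtain ⟨l, hl, rfl⟩ := hx
    obtain ⟨m, hm, rfl⟩ := hy
    refine ⟨l ++ m, fun j hj => ?_, by simp⟩
    rcases List.mem_append.1 hj with h | h
    exacts [hl j h, hm j h]

theorem word_mem (b : R.Base) {l : List ι} (hl : ∀ j ∈ l, j ∈ b.support) :
    (l.map R.reflection).prod ∈ weylGroup b := by
  refine Subgroup.list_prod_mem _ fun x hx => ?_
  obtain ⟨j, hj, rfl⟩ := List.mem_map.1 hx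
  exact simple_reflection_mem b (hl j hj)

/-- An induction principle for the Weyl group. -/
theorem weylGroup_induction (b : R.Base) 
    {p : ∀ w : E ≃ₗ[ℝ] E, w ∈ weylGroup b → Prop} (one : p 1 (one_mem _))
    (mul : ∀ i (hi : i ∈ b.support) w hw, p w hw →
      p (R.reflection i * w) (mul_mem (simple_reflection_mem b hi) hw))
    {w : E ≃ₗ[ℝ] E} (hw : w ∈ weylGroup b) : p w hw := by
  obtain ⟨l, hl, rfl⟩ := exists_word b hw
  induction l with
  | nil => simpa using one
  | cons i l ih =>
    have h : ∀ j ∈ l, j ∈ b.support := fun j h => hl j (by simp [h])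
    simpa using mul i (hl i (by simp)) _ _ (ih h (word_mem b h))

theorem inner_weylGroup (hR : IsEuclidean R) (b : R.Base) {w : E ≃ₗ[ℝ] E} (hw : w ∈ weylGroup b)
    (x y : E) : ⟪w x, w y⟫_ℝ = ⟪x, y⟫_ℝ := by
  induction hw using weylGroup_induction b with
  | one => rfl
  | mul i _ w _ ih => exact (hR.inner_reflection i _ _).trans ih

theorem inner_weylGroup_left (hR : IsEuclidean R) (b : R.Base) {w : E ≃ₗ[ℝ] E}
    (hw : w ∈ weylGroup b) (x y : E) : ⟪w x, y⟫_ℝ = ⟪x, w⁻¹ y⟫_ℝ := by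
  rw [← inner_weylGroup hR b hw x]
  exact congrArg _ (w.apply_symm_apply y).symm

theorem weylGroup_root (b : R.Base) {w : E ≃ₗ[ℝ] E} (hw : w ∈ weylGroup b) (i : ι) :
    ∃ j, w (R.root i) = R.root j := by
  induction hw using weylGroup_induction b with
  | one => exact ⟨i, rfl⟩
  | mul k _ w _ ih =>
    obtain ⟨j, hj⟩ := ih
    refine ⟨R.reflectionPerm k j, ?_⟩
    rw [R.root_reflectionPerm, ← hj]
    rfl

theorem weylGroup_coroot_of_root (hR : IsEuclidean R) (b : R.Base) {w : E ≃ₗ[ℝ] E}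
    (hw : w ∈ weylGroup b) {i j : ι} (h : w (R.root i) = R.root j) :
    w (R.coroot i) = R.coroot j := by
  rw [hR.coroot_eq, hR.coroot_eq, map_smul, h, ← inner_weylGroup hR b hw (R.root i), h]

theorem det_weylGroup [FiniteDimensional ℝ E] (b : R.Base) {w : E ≃ₗ[ℝ] E}
    (hw : w ∈ weylGroup b) : LinearEquiv.det w = 1 ∨ LinearEquiv.det w = -1 := by
  induction hw using weylGroup_induction b with
  | one => simp
  | mul k _ w _ ih =>
    rw [map_mul, det_reflection]
    rcases ih with h | h <;> simp [h]

theorem mem_evenWeylGroup [FiniteDimensional ℝ E] (b : R.Base) {w : E ≃ₗ[ℝ] E} :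
    w ∈ evenWeylGroup b ↔ w ∈ weylGroup b ∧ LinearEquiv.det w = 1 := Iff.rfl

theorem units_neg_one_ne_one : (-1 : ℝˣ) ≠ 1 := by
  intro h
  have := congrArg Units.val h
  norm_num at this

/-- An odd element of the Weyl group becomes even when multiplied by a reflection. -/
theorem mem_even_or_mul_reflection_mem_even [FiniteDimensional ℝ E] [Finite ι]
    [R.IsCrystallographic] [R.IsReduced] (b : R.Base) (a : ι) {w : E ≃ₗ[ℝ] E}
    (hw : w ∈ weylGroup b) : w ∈ evenWeylGroup b ∨ w * R.reflection a ∈ evenWeylGroup b := by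
  rcases det_weylGroup b hw with h | h
  · exact Or.inl ⟨hw, h⟩
  · refine Or.inr ⟨mul_mem hw (reflection_mem_weylGroup b a), ?_⟩
    change LinearEquiv.det (w * R.reflection a) = 1
    rw [map_mul, h, det_reflection]
    simp

/-- An isometry that carries one root to another carries the coroot along, and so conjugates the
reflections. -/
theorem weylGroup_conj_reflection (hR : IsEuclidean R) (b : R.Base) {w : E ≃ₗ[ℝ] E}
    (hw : w ∈ weylGroup b) {i j : ι} (h : w (R.root i) = R.root j) :
    R.reflection j * w = w * R.reflection i := by
  ext x
  change R.reflection j (w x) = w (R.reflection i x)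
  rw [hR.reflection_apply, hR.reflection_apply, map_sub, map_smul, h,
    ← weylGroup_coroot_of_root hR b hw h, inner_weylGroup hR b hw]

/-! ### Simple transitivity on chambers -/

theorem inner_root_nonneg_of_isPos [Finite ι] [R.IsCrystallographic] {b : R.Base} {x : E}
    (hx : x ∈ dominantChamber b) {i : ι} (hi : b.IsPos i) : 0 ≤ ⟪x, R.root i⟫_ℝ := by
  refine hi.induction_on_add (p := fun i => 0 ≤ ⟪x, R.root i⟫_ℝ) hx ?_
  intro i j k hk hi hj
  rw [hk, inner_add_right]
  exact add_nonneg hi (hx j hj)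

theorem root_reflectionPerm_self_eq_neg (i : ι) :
    R.root (R.reflectionPerm i i) = - R.root i := by
  rw [R.root_reflectionPerm, R.reflection_apply_self]

/-- The exchange condition. -/
theorem exchange [Finite ι] [R.IsCrystallographic] [R.IsReduced] (hR : IsEuclidean R) (b : R.Base)
    {i : ι} (hi : i ∈ b.support) (l : List ι) (hl : ∀ j ∈ l, j ∈ b.support) {k : ι}
    (hk : (l.map R.reflection).prod (R.root i) = R.root k) (hneg : ¬ b.IsPos k) :
    ∃ m : List ι, (∀ j ∈ m, j ∈ b.support) ∧ m.length < l.length ∧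
      (m.map R.reflection).prod = (l.map R.reflection).prod * R.reflection i := by
  induction l generalizing k with
  | nil =>
    have : i = k := R.root.injective (by simpa using hk)
    exact absurd (RootPairing.Base.isPos_of_mem_support (this ▸ hi)) hneg
  | cons j t ih =>
    have hj : j ∈ b.support := hl j (by simp)
    have ht : ∀ j ∈ t, j ∈ b.support := fun j h => hl j (by simp [h])
    have hwt := word_mem b ht
    obtain ⟨m, hm⟩ := weylGroup_root b hwt i
    by_cases hpos : b.IsPos m
    · have hkm : k = R.reflectionPerm j m := by
        apply R.root.injective
        rw [R.root_reflectionPerm, ← hm, ← hk]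
        simp
      -- The sign changes exactly at the letter `j`. A simple reflection permutes the positive roots
      -- other than its own, so the root reached just before must be that simple root.
      have hmj : m = j := by
        by_contra hne
        exact hneg (hkm ▸ hpos.reflectionPerm hj hne)
      refine ⟨t, ht, by simp, ?_⟩
      -- The letter `j` moves through `t` and becomes `i`, where it cancels the final reflection;
      -- what remains is `t`.
      rw [List.map_cons, List.prod_cons,
        weylGroup_conj_reflection hR b hwt (hmj ▸ hm), mul_assoc, ← sq, R.reflection_sq, mul_one]
    · obtain ⟨m', h1, h2, h3⟩ := ih ht hm hpos
      refine ⟨j :: m', ?_, by simpa using h2, by simp [h3, mul_assoc]⟩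
      intro x hx
      rcases List.mem_cons.1 hx with rfl | h
      exacts [hj, h1 x h]

/-- A point of the closed dominant chamber is the only point of its orbit there, and it has trivial
stabilizer if it is strictly dominant. -/
theorem eq_of_word_dominant [Finite ι] [R.IsCrystallographic] [R.IsReduced] (hR : IsEuclidean R)
    (b : R.Base) {x : E} (hx : x ∈ dominantChamber b) (n : ℕ) :
    ∀ l : List ι, l.length = n → (∀ j ∈ l, j ∈ b.support) →
      (l.map R.reflection).prod x ∈ dominantChamber b →
      (l.map R.reflection).prod x = x ∧
        ((∀ i ∈ b.support, 0 < ⟪x, R.root i⟫_ℝ) → (l.map R.reflection).prod = 1) := by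
  induction n using Nat.strong_induction_on with
  | _ n ih =>
    intro l hn hl hlx
    rcases List.eq_nil_or_concat l with rfl | ⟨t, i, rfl⟩
    · simp
    have hi : i ∈ b.support := hl i (by simp)
    have ht : ∀ j ∈ t, j ∈ b.support := fun j h => hl j (by simp [h])
    have hwt := word_mem b ht
    have hw := word_mem b hl
    have hprod : ((t.concat i).map R.reflection).prod =
        (t.map R.reflection).prod * R.reflection i := by simp
    rw [hprod] at hlx hw ⊢
    have hlen : (t.concat i).length = t.length + 1 := by simp
    obtain ⟨k, hk⟩ := weylGroup_root b hwt i
    -- If `t` keeps the last simple root positive, dominance of both `x` and its image forces `⟪x,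
    -- α_i⟫ = 0`, so the last letter fixes `x` and can be dropped. Otherwise the exchange condition
    -- shortens the word.
    by_cases hpos : b.IsPos k
    · have h1 := inner_root_nonneg_of_isPos hlx hpos
      have h2 : ((t.map R.reflection).prod * R.reflection i) (R.root i) = - R.root k := by
        rw [← hk]
        change (t.map R.reflection).prod (R.reflection i (R.root i)) = _
        rw [R.reflection_apply_self, map_neg]
      have h3 := inner_weylGroup hR b hw x (R.root i)
      rw [h2, inner_neg_right] at h3
      have h4 : ⟪x, R.root i⟫_ℝ = 0 := le_antisymm (by linarith) (hx i hi)
      have h5 : R.reflection i x = x := by rw [hR.reflection_apply', h4]; simp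
      have h6 : ((t.map R.reflection).prod * R.reflection i) x = (t.map R.reflection).prod x :=
        congrArg _ h5
      rw [h6] at hlx ⊢
      refine ⟨(ih _ (by lia) t rfl ht hlx).1, fun hs => ?_⟩
      exact absurd h4 (hs i hi).ne'
    · obtain ⟨m, hm, hml, hme⟩ := exchange hR b hi t ht hk hpos
      rw [← hme] at hlx ⊢
      exact ih _ (by lia) m rfl hm hlx

theorem weylGroup_dominant_unique [Finite ι] [R.IsCrystallographic] [R.IsReduced]
    (hR : IsEuclidean R) (b : R.Base) {x : E} (hx : x ∈ dominantChamber b) {w : E ≃ₗ[ℝ] E}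
    (hw : w ∈ weylGroup b) (hwx : w x ∈ dominantChamber b) : w x = x := by
  obtain ⟨l, hl, rfl⟩ := exists_word b hw
  exact (eq_of_word_dominant hR b hx _ l rfl hl hwx).1

theorem weylGroup_eq_one_of_dominant [Finite ι] [R.IsCrystallographic] [R.IsReduced]
    (hR : IsEuclidean R) (b : R.Base) {x : E} (hx : ∀ i ∈ b.support, 0 < ⟪x, R.root i⟫_ℝ)
    {w : E ≃ₗ[ℝ] E} (hw : w ∈ weylGroup b) (hwx : w x ∈ dominantChamber b) : w = 1 := by
  obtain ⟨l, hl, rfl⟩ := exists_word b hw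
  exact (eq_of_word_dominant hR b (fun i hi => (hx i hi).le) _ l rfl hl hwx).2 hx

theorem exists_strictly_dominant [FiniteDimensional ℝ E] [R.IsRootSystem] (b : R.Base) :
    ∃ x : E, ∀ i ∈ b.support, ⟪x, R.root i⟫_ℝ = 1 := by
  let φ : E →ₗ[ℝ] ℝ := b.toWeightBasis.constr ℝ (fun _ => (1 : ℝ))
  refine ⟨(InnerProductSpace.toDual ℝ E).symm (LinearMap.toContinuousLinearMap φ), fun i hi => ?_⟩
  rw [InnerProductSpace.toDual_symm_apply]
  have := b.toWeightBasis.constr_basis ℝ (fun _ => (1 : ℝ)) ⟨i, hi⟩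
  rwa [b.toWeightBasis_apply] at this

/-- Choose the orbit point with the largest scalar product with a strictly dominant vector. Were it
negative on a simple root, reflecting in that root would increase the product. -/
theorem exists_weylGroup_dominant [Finite ι] [FiniteDimensional ℝ E] [R.IsRootSystem]
    (hR : IsEuclidean R) (b : R.Base) (x : E) :
    ∃ w ∈ weylGroup b, w x ∈ dominantChamber b := by
  obtain ⟨r, hr⟩ := exists_strictly_dominant b
  have := finite_weylGroup b
  obtain ⟨w, hw⟩ := Finite.exists_max fun w : weylGroup b => ⟪(w : E ≃ₗ[ℝ] E) x, r⟫_ℝ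
  refine ⟨w, w.2, fun i hi => ?_⟩
  have h := hw (⟨R.reflection i, simple_reflection_mem b hi⟩ * w)
  change ⟪R.reflection i ((w : E ≃ₗ[ℝ] E) x), r⟫_ℝ ≤ _ at h
  rw [hR.reflection_apply, inner_sub_left, inner_smul_left, real_inner_comm, real_inner_comm r,
    hr i hi, hR.coroot_eq, inner_smul_right] at h
  rw [real_inner_comm] at h
  have h2 : 0 < 2 / ⟪R.root i, R.root i⟫_ℝ := div_pos two_pos (inner_root_self_pos R i)
  simp only [RCLike.conj_to_real, mul_one] at h
  nlinarith

end EOrbit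

namespace EOrbit

set_option linter.unusedSectionVars false

variable {ι E : Type*} [NormedAddCommGroup E] [InnerProductSpace ℝ E] {R : RootPairing ι ℝ E E}

/-! ### The closed fundamental simplex and the closure of the even domain -/

/-- The closed fundamental simplex of the affine Weyl group. -/
def closedAlcove (b : R.Base) (θ : ι) : Set E :=
  {x | x ∈ dominantChamber b ∧ ⟪x, R.root θ⟫_ℝ ≤ 1}

/-- The points on which all roots take values in `[-1, 1]`. -/
def rootBox (R : RootPairing ι ℝ E E) : Set E :=
  {x | ∀ i, |⟪x, R.root i⟫_ℝ| ≤ 1}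

theorem isClosed_closedAlcove (b : R.Base) (θ : ι) : IsClosed (closedAlcove b θ) := by
  have h : closedAlcove b θ =
      (⋂ i ∈ b.support, {x | 0 ≤ ⟪x, R.root i⟫_ℝ}) ∩ {x | ⟪x, R.root θ⟫_ℝ ≤ 1} := by
    ext x; simp [closedAlcove, dominantChamber]
  rw [h]
  refine (isClosed_biInter fun i _ => ?_).inter ?_
  · exact isClosed_le continuous_const (by fun_prop)
  · exact isClosed_le (by fun_prop) continuous_const

theorem convex_closedAlcove (b : R.Base) (θ : ι) : Convex ℝ (closedAlcove b θ) := by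
  intro x hx y hy s t hs ht hst
  refine ⟨fun i hi => ?_, ?_⟩
  · rw [inner_add_left, real_inner_smul_left, real_inner_smul_left]
    have := hx.1 i hi
    have := hy.1 i hi
    positivity
  · rw [inner_add_left, real_inner_smul_left, real_inner_smul_left]
    have := hx.2
    have := hy.2
    nlinarith

theorem interior_closedAlcove_nonempty [FiniteDimensional ℝ E] [R.IsRootSystem]
    (b : R.Base) (θ : ι) : (interior (closedAlcove b θ)).Nonempty := by
  obtain ⟨r, hr⟩ := exists_strictly_dominant b
  have hopen : IsOpen ((⋂ i ∈ b.support, {x : E | 0 < ⟪x, R.root i⟫_ℝ}) ∩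
      {x | ⟪x, R.root θ⟫_ℝ < 1}) := by
    refine (isOpen_biInter_finset fun i _ => ?_).inter ?_
    · exact isOpen_lt continuous_const (by fun_prop)
    · exact isOpen_lt (by fun_prop) continuous_const
  -- A strictly dominant vector is shrunk until its value on the highest root drops below 1.
  refine ⟨(1 / (|⟪r, R.root θ⟫_ℝ| + 1)) • r, interior_maximal ?_ hopen ⟨?_, ?_⟩⟩
  · rintro x ⟨h1, h2⟩
    simp only [Set.mem_iInter] at h1
    exact ⟨fun i hi => (h1 i hi).le, le_of_lt h2⟩
  · simp only [Set.mem_iInter]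
    intro i hi
    simp only [Set.mem_ofPred_eq, real_inner_smul_left, hr i hi]
    positivity
  · simp only [Set.mem_ofPred_eq, real_inner_smul_left]
    rw [div_mul_eq_mul_div, one_mul, div_lt_one (by positivity)]
    linarith [le_abs_self ⟪r, R.root θ⟫_ℝ]

theorem closure_affineDomain [FiniteDimensional ℝ E] [R.IsRootSystem] (b : R.Base) (θ : ι) :
    closure (affineDomain b θ) = closedAlcove b θ := by
  change closure (interior (closedAlcove b θ)) = _
  rw [(convex_closedAlcove b θ).closure_interior_eq_closure_of_nonempty_interior
    (interior_closedAlcove_nonempty b θ), (isClosed_closedAlcove b θ).closure_eq]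

/-- Removing the frontier of the closed union leaves its interior, which contains the interiors of
both simplices; each simplex is the closure of its own interior. -/
theorem closure_evenAffineDomain [FiniteDimensional ℝ E] [R.IsRootSystem] (b : R.Base) (θ a : ι) :
    closure (evenAffineDomain b θ a) =
      closedAlcove b θ ∪ R.reflection a '' closedAlcove b θ := by
  let e : E ≃ₜ E := (R.reflection a).toContinuousLinearEquiv.toHomeomorph
  have he : ∀ s : Set E, R.reflection a '' s = e '' s := fun s => rfl
  have hS := closure_affineDomain b θ
  have hcl : IsClosed (closedAlcove b θ ∪ R.reflection a '' closedAlcove b θ) := by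
    rw [he]
    exact (isClosed_closedAlcove b θ).union (e.isClosed_image.2 (isClosed_closedAlcove b θ))
  rw [evenAffineDomain, hS, self_sdiff_frontier]
  refine subset_antisymm (hcl.closure_subset_iff.2 interior_subset) (Set.union_subset ?_ ?_)
  · rw [← hS]
    refine closure_mono ?_
    rw [hS]
    exact interior_mono Set.subset_union_left
  · rw [he]
    nth_rw 1 [← hS]
    rw [e.image_closure]
    refine closure_mono ?_
    change e '' interior (closedAlcove b θ) ⊆ _
    rw [e.image_interior]
    exact interior_mono Set.subset_union_right

theorem mem_closure_evenAffineDomain [FiniteDimensional ℝ E] [R.IsRootSystem]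
    (b : R.Base) (θ a : ι) (x : E) :
    x ∈ closure (evenAffineDomain b θ a) ↔
      x ∈ closedAlcove b θ ∨ R.reflection a x ∈ closedAlcove b θ := by
  rw [closure_evenAffineDomain, Set.mem_union]
  refine or_congr Iff.rfl ⟨?_, fun h => ⟨_, h, R.reflection_same a x⟩⟩
  rintro ⟨y, hy, rfl⟩
  rwa [R.reflection_same]

/-- On the dominant chamber the highest root dominates every root, and the roots come in pairs `±β`.
This trades the condition on `ξ` for one that is invariant under the Weyl group. -/
theorem closedAlcove_eq {b : R.Base} {θ : ι} (hθ : IsHighestRoot b θ) :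
    closedAlcove b θ = dominantChamber b ∩ rootBox R := by
  ext x
  refine ⟨fun ⟨h1, h2⟩ => ⟨h1, ?_⟩, fun ⟨h1, h2⟩ => ⟨h1, (le_abs_self _).trans (h2 θ)⟩⟩
  have key : ∀ i, ⟪x, R.root i⟫_ℝ ≤ 1 := by
    intro i
    have : 0 ≤ ⟪x, R.root θ - R.root i⟫_ℝ := by
      refine AddSubmonoid.closure_induction (motive := fun y _ => 0 ≤ ⟪x, y⟫_ℝ) ?_ ?_ ?_ (hθ i)
      · rintro _ ⟨j, hj, rfl⟩
        exact h1 j hj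
      · simp
      · intro y z _ _ hy hz
        rw [inner_add_right]
        exact add_nonneg hy hz
    rw [inner_sub_right] at this
    linarith
  intro i
  refine abs_le.2 ⟨?_, key i⟩
  have := key (R.reflectionPerm i i)
  rw [root_reflectionPerm_self_eq_neg, inner_neg_right] at this
  linarith

theorem reflection_mem_rootBox (hR : IsEuclidean R) {x : E} (hx : x ∈ rootBox R)
    (k : ι) : R.reflection k x ∈ rootBox R := by
  intro i
  rw [← hR.inner_reflection k, R.reflection_same, ← R.root_reflectionPerm]
  exact hx _

theorem weylGroup_mem_rootBox (hR : IsEuclidean R) (b : R.Base) {w : E ≃ₗ[ℝ] E}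
    (hw : w ∈ weylGroup b) {x : E} (hx : x ∈ rootBox R) : w x ∈ rootBox R := by
  intro i
  obtain ⟨j, hj⟩ := weylGroup_root b (inv_mem hw) i
  rw [inner_weylGroup_left hR b hw, hj]
  exact hx j

/-! ### Tiling of the root box by the even Weyl group -/

section Domain

variable [Finite ι] [FiniteDimensional ℝ E] [R.IsRootSystem] [R.IsCrystallographic] [R.IsReduced]

theorem closure_evenAffineDomain_subset (hR : IsEuclidean R) {b : R.Base} {θ : ι}
    (hθ : IsHighestRoot b θ) (a : ι) : closure (evenAffineDomain b θ a) ⊆ rootBox R := by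
  intro x hx
  rw [mem_closure_evenAffineDomain, closedAlcove_eq hθ] at hx
  rcases hx with hx | hx
  · exact hx.2
  · have := weylGroup_mem_rootBox hR b (reflection_mem_weylGroup b a) hx.2
    rwa [R.reflection_same] at this

theorem reflection_mul_mem_even (b : R.Base) (a : ι) {w : E ≃ₗ[ℝ] E}
    (hw : w ∈ weylGroup b) (hn : w ∉ evenWeylGroup b) :
    R.reflection a * w ∈ evenWeylGroup b := by
  rcases mem_even_or_mul_reflection_mem_even b a (inv_mem hw) with h | h
  · exact absurd (by simpa using inv_mem h) hn
  · have := inv_mem h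
    rwa [mul_inv_rev, inv_inv, R.reflection_inv] at this

/-- An element moving `x` into the chamber may be odd; a further `r_α` corrects the parity and puts
the point in the mirrored alcove. -/
theorem exists_even_mem_closure (hR : IsEuclidean R) {b : R.Base} {θ : ι}
    (hθ : IsHighestRoot b θ) (a : ι) {x : E} (hx : x ∈ rootBox R) :
    ∃ w ∈ evenWeylGroup b, w x ∈ closure (evenAffineDomain b θ a) := by
  obtain ⟨w, hw, hwx⟩ := exists_weylGroup_dominant hR b x
  have hS : w x ∈ closedAlcove b θ := by
    rw [closedAlcove_eq hθ]
    exact ⟨hwx, weylGroup_mem_rootBox hR b hw hx⟩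
  by_cases h : w ∈ evenWeylGroup b
  · exact ⟨w, h, (mem_closure_evenAffineDomain b θ a _).2 (Or.inl hS)⟩
  · refine ⟨_, reflection_mul_mem_even b a hw h, (mem_closure_evenAffineDomain b θ a _).2 (Or.inr ?_)⟩
    change R.reflection a (R.reflection a (w x)) ∈ _
    rwa [R.reflection_same]

theorem reflection_mul_even_ne_one (b : R.Base) (a : ι) {w : E ≃ₗ[ℝ] E}
    (hw : w ∈ evenWeylGroup b) : R.reflection a * w ≠ 1 := by
  intro h
  have h1 := congrArg LinearEquiv.det h
  rw [map_mul, det_reflection, ((mem_evenWeylGroup b).1 hw).2, map_one, mul_one] at h1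
  exact units_neg_one_ne_one h1

theorem even_mul_reflection_ne_one (b : R.Base) (a : ι) {w : E ≃ₗ[ℝ] E}
    (hw : w ∈ evenWeylGroup b) : w * R.reflection a ≠ 1 := by
  intro h
  have h1 := congrArg LinearEquiv.det h
  rw [map_mul, det_reflection, ((mem_evenWeylGroup b).1 hw).2, map_one, one_mul] at h1
  exact units_neg_one_ne_one h1

theorem reflection_conj_eq_one (a : ι) {w : E ≃ₗ[ℝ] E}
    (h : R.reflection a * (w * R.reflection a) = 1) : w = 1 := by
  have h2 : w * R.reflection a = R.reflection a := by
    have := congrArg (R.reflection a * ·) h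
    simpa only [← mul_assoc, ← sq, R.reflection_sq, one_mul, mul_one] using this
  exact mul_eq_right.1 h2

theorem pos_of_regular {b : R.Base} {x : E} (hx : x ∈ dominantChamber b)
    (hreg : ∀ i, ⟪x, R.root i⟫_ℝ ≠ 0) : ∀ i ∈ b.support, 0 < ⟪x, R.root i⟫_ℝ :=
  fun i hi => lt_of_le_of_ne (hx i hi) (hreg i).symm

theorem regular_reflection (hR : IsEuclidean R) (a : ι) {x : E}
    (hreg : ∀ i, ⟪x, R.root i⟫_ℝ ≠ 0) (i : ι) : ⟪R.reflection a x, R.root i⟫_ℝ ≠ 0 := by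
  have := hreg (R.reflectionPerm a i)
  rwa [R.root_reflectionPerm, ← hR.inner_reflection a, R.reflection_same] at this

/-- Regular points of the even domain are not identified by the even Weyl group. -/
theorem even_eq_one_of_regular (hR : IsEuclidean R) {b : R.Base} {θ a : ι} {x : E}
    (hx : x ∈ closure (evenAffineDomain b θ a)) (hreg : ∀ i, ⟪x, R.root i⟫_ℝ ≠ 0)
    {w : E ≃ₗ[ℝ] E} (hw : w ∈ evenWeylGroup b)
    (hwx : w x ∈ closure (evenAffineDomain b θ a)) : w = 1 := by
  have hr := reflection_mem_weylGroup b a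
  have hww := ((mem_evenWeylGroup b).1 hw).1
  rw [mem_closure_evenAffineDomain] at hx hwx
  rcases hx with hx | hx <;> rcases hwx with hwx | hwx
  -- In each case a product of `w` with copies of `r_α` maps a strictly dominant point into the
  -- chamber and is therefore 1. In the two mixed cases that product is odd, which is absurd.
  · exact weylGroup_eq_one_of_dominant hR b (pos_of_regular hx.1 hreg) hww hwx.1
  · exact absurd (weylGroup_eq_one_of_dominant hR b (pos_of_regular hx.1 hreg)
      (mul_mem hr hww) hwx.1) (reflection_mul_even_ne_one b a hw)
  · refine absurd (weylGroup_eq_one_of_dominant hR b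
      (pos_of_regular hx.1 (regular_reflection hR a hreg)) (mul_mem hww hr) ?_)
      (even_mul_reflection_ne_one b a hw)
    change w (R.reflection a (R.reflection a x)) ∈ _
    rw [R.reflection_same]
    exact hwx.1
  · apply reflection_conj_eq_one (R := R) a
    refine weylGroup_eq_one_of_dominant hR b
      (pos_of_regular hx.1 (regular_reflection hR a hreg)) (mul_mem hr (mul_mem hww hr)) ?_
    change R.reflection a (w (R.reflection a (R.reflection a x))) ∈ _
    rw [R.reflection_same]
    exact hwx.1

/-! ### Representatives of the even orbits of weights -/

/-- The coroot lattice as a `ℤ`-submodule. -/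
abbrev corootSpan (b : R.Base) : Submodule ℤ E :=
  Submodule.span ℤ (Set.range b.toCoweightBasis)

theorem coroot_mem_corootSpan (b : R.Base) (i : ι) : R.coroot i ∈ corootSpan b := by
  have h : Set.range b.toCoweightBasis = R.coroot '' (b.support : Set ι) := by
    ext x
    simp [eq_comm]
  rw [corootSpan, h]
  exact b.coroot_mem_span_int i

theorem inner_corootSpan_weight {b : R.Base} {q l : E} (hq : q ∈ corootSpan b)
    (hl : l ∈ weightLattice b) : ∃ m : ℤ, ⟪q, l⟫_ℝ = m := by
  induction hq using Submodule.span_induction with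
  | mem x hx =>
    obtain ⟨⟨i, hi⟩, rfl⟩ := hx
    rw [b.toCoweightBasis_apply]
    exact hl i hi
  | zero => exact ⟨0, by simp⟩
  | add x y _ _ hx hy =>
    obtain ⟨m, hm⟩ := hx
    obtain ⟨n, hn⟩ := hy
    exact ⟨m + n, by rw [inner_add_left, hm, hn]; push_cast; rfl⟩
  | smul c x _ hx =>
    obtain ⟨m, hm⟩ := hx
    refine ⟨c * m, ?_⟩
    rw [← Int.cast_smul_eq_zsmul ℝ, real_inner_smul_left, hm]
    push_cast; rfl

theorem root_mem_weightLattice (hR : IsEuclidean R) (b : R.Base) (i : ι) :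
    R.root i ∈ weightLattice b := by
  intro j _
  refine ⟨R.pairingIn ℤ i j, ?_⟩
  rw [real_inner_comm, hR.inner_root_coroot]
  exact (R.algebraMap_pairingIn ℤ i j).symm

theorem weightLattice_sub {b : R.Base} {l m : E} (hl : l ∈ weightLattice b)
    (hm : m ∈ weightLattice b) : l - m ∈ weightLattice b := by
  intro i hi
  obtain ⟨u, hu⟩ := hl i hi
  obtain ⟨v, hv⟩ := hm i hi
  exact ⟨u - v, by rw [inner_sub_right, hu, hv]; push_cast; rfl⟩

theorem weightLattice_neg {b : R.Base} {l : E} (hl : l ∈ weightLattice b) :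
    -l ∈ weightLattice b := by
  intro i hi
  obtain ⟨u, hu⟩ := hl i hi
  exact ⟨-u, by rw [inner_neg_right, hu]; push_cast; rfl⟩

theorem weightLattice_weylGroup (hR : IsEuclidean R) {b : R.Base} {w : E ≃ₗ[ℝ] E}
    (hw : w ∈ weylGroup b) {l : E} (hl : l ∈ weightLattice b) : w l ∈ weightLattice b := by
  intro i _
  obtain ⟨j, hj⟩ := weylGroup_root b (inv_mem hw) i
  have h : ⟪R.coroot i, w l⟫_ℝ = ⟪R.coroot j, l⟫_ℝ := by
    rw [real_inner_comm, inner_weylGroup_left hR b hw, real_inner_comm,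
      weylGroup_coroot_of_root hR b (inv_mem hw) hj]
  rw [h]
  exact inner_corootSpan_weight (coroot_mem_corootSpan b j) hl

theorem evenDominantWeights_subset (hR : IsEuclidean R) (b : R.Base) (a : ι) :
    evenDominantWeights b a ⊆ weightLattice b := by
  rintro l (hl | ⟨m, hm, rfl⟩)
  · exact hl.1
  · exact weightLattice_weylGroup hR (reflection_mem_weylGroup b a) hm.1

/-- When the element making `l` dominant is odd, a strictly dominant image is reflected by `r_α`,
while an image on a wall is fixed by the reflection in that wall, which corrects the parity at no
cost. -/
theorem exists_even_mem_evenDominantWeights (hR : IsEuclidean R) (b : R.Base) (a : ι) {l : E}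
    (hl : l ∈ weightLattice b) : ∃ w ∈ evenWeylGroup b, w l ∈ evenDominantWeights b a := by
  obtain ⟨w, hw, hwl⟩ := exists_weylGroup_dominant hR b l
  have hP := weightLattice_weylGroup hR hw hl
  by_cases h : w ∈ evenWeylGroup b
  · exact ⟨w, h, Or.inl ⟨hP, hwl⟩⟩
  by_cases hs : ∀ i ∈ b.support, 0 < ⟪w l, R.root i⟫_ℝ
  · exact ⟨_, reflection_mul_mem_even b a hw h, Or.inr ⟨w l, ⟨hP, hs⟩, rfl⟩⟩
  · push Not at hs
    obtain ⟨i, hi, hle⟩ := hs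
    have h0 : ⟪w l, R.root i⟫_ℝ = 0 := le_antisymm hle (hwl i hi)
    refine ⟨_, reflection_mul_mem_even b i hw h, Or.inl ?_⟩
    change R.reflection i (w l) ∈ _
    rw [hR.reflection_apply', h0, zero_smul, sub_zero]
    exact ⟨hP, hwl⟩

/-- An even element cannot link `P_+` with `r_α P_+^+`: composed with `r_α` it would be an odd
element between dominant points, one of them strictly dominant, hence the identity. -/
theorem evenDominantWeights_unique (hR : IsEuclidean R) (b : R.Base) (a : ι) {l : E}
    (hl : l ∈ evenDominantWeights b a) {w : E ≃ₗ[ℝ] E} (hw : w ∈ evenWeylGroup b)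
    (hwl : w l ∈ evenDominantWeights b a) : w l = l := by
  have hr := reflection_mem_weylGroup b a
  have hww := ((mem_evenWeylGroup b).1 hw).1
  rcases hl with hl | ⟨m, hm, rfl⟩ <;> rcases hwl with hwl | ⟨m', hm', he⟩
  · exact weylGroup_dominant_unique hR b hl.2 hww hwl.2
  · have hdom : ∀ x ∈ strictlyDominantWeights b, x ∈ dominantChamber b :=
      fun x hx i hi => (hx.2 i hi).le
    have h1 : (R.reflection a * w) l = m' := by
      change R.reflection a (w l) = m'
      rw [← he, R.reflection_same]
    have h2 := weylGroup_dominant_unique hR b hl.2 (mul_mem hr hww) (h1 ▸ hdom m' hm')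
    have h3 : l = m' := h2.symm.trans h1
    exact absurd (weylGroup_eq_one_of_dominant hR b (h3 ▸ hm'.2) (mul_mem hr hww)
      (h1 ▸ hdom m' hm')) (reflection_mul_even_ne_one b a hw)
  · exact absurd (weylGroup_eq_one_of_dominant hR b hm.2 (mul_mem hww hr) hwl.2)
      (even_mul_reflection_ne_one b a hw)
  · have h1 : (R.reflection a * (w * R.reflection a)) m = m' := by
      change R.reflection a (w (R.reflection a m)) = m'
      rw [← he, R.reflection_same]
    have h2 := weylGroup_eq_one_of_dominant hR b hm.2 (mul_mem hr (mul_mem hww hr))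
      (h1 ▸ fun i hi => (hm'.2 i hi).le)
    rw [reflection_conj_eq_one (R := R) a h2]
    rfl

/-! ### Translations by the coroot lattice -/

/-- Signs are absorbed because the negative of a coroot is a coroot, so the number of summands can
serve for induction. -/
theorem exists_list_of_mem_corootSpan (b : R.Base) {q : E} (hq : q ∈ corootSpan b) :
    ∃ l : List ι, (l.map R.coroot).sum = q := by
  rw [corootSpan, ← Submodule.mem_toAddSubgroup, Submodule.span_int_eq_addSubgroupClosure] at hq
  induction hq using AddSubgroup.closure_induction'' with
  | zero => exact ⟨[], by simp⟩
  | mem x hx =>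
    obtain ⟨i, rfl⟩ := hx
    exact ⟨[i], by simp⟩
  | neg_mem x hx =>
    obtain ⟨i, rfl⟩ := hx
    refine ⟨[R.reflectionPerm i i], ?_⟩
    simp [R.coroot_reflectionPerm, R.coreflection_apply_self]
  | add x y _ _ hx hy =>
    obtain ⟨l, rfl⟩ := hx
    obtain ⟨m, rfl⟩ := hy
    exact ⟨l ++ m, by simp⟩

/-- The coroot lattice contains no nonzero vector on which all roots take values in
`{-1, 0, 1}`. -/
theorem eq_zero_of_mem_corootSpan_of_mem_rootBox (hR : IsEuclidean R) (b : R.Base) {q : E}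
    (hq : q ∈ corootSpan b) (hbox : q ∈ rootBox R) : q = 0 := by
  suffices H : ∀ n : ℕ, ∀ l : List ι, l.length = n → (l.map R.coroot).sum ∈ rootBox R →
      (l.map R.coroot).sum = 0 by
    obtain ⟨l, rfl⟩ := exists_list_of_mem_corootSpan b hq
    exact H _ l rfl hbox
  clear hbox hq q
  intro n
  induction n with
  | zero => intro l hl _; simp [List.length_eq_zero_iff.1 hl]
  | succ n ih =>
    intro l hl hbox
    by_contra hne
    set q := (l.map R.coroot).sum with hq
    have hmem : ∀ l : List ι, (l.map R.coroot).sum ∈ corootSpan b := fun l =>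
      list_sum_mem fun x hx => by
        obtain ⟨j, -, rfl⟩ := List.mem_map.1 hx
        exact coroot_mem_corootSpan b j
    have hpos : 0 < ⟪q, q⟫_ℝ := real_inner_self_pos.2 hne
    -- `⟪q, q⟫ > 0` is the sum of the products of `q` with the listed coroots, so one of them is
    -- positive.
    obtain ⟨k, hk, hkpos⟩ : ∃ k ∈ l, 0 < ⟪q, R.coroot k⟫_ℝ := by
      by_contra! hcon
      have : ∀ m : List ι, (∀ k ∈ m, ⟪q, R.coroot k⟫_ℝ ≤ 0) →
          ⟪q, (m.map R.coroot).sum⟫_ℝ ≤ 0 := by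
        intro m
        induction m with
        | nil => simp
        | cons k m ihm =>
          intro h
          rw [List.map_cons, List.sum_cons, inner_add_right]
          exact add_nonpos (h k (by simp)) (ihm fun j hj => h j (by simp [hj]))
      exact absurd (this l hcon) (not_le.2 hpos)
    -- The value is a positive integer, and the box bounds it by 1. Hence reflecting in this root
    -- removes just one coroot from the sum and stays in the box, so induction applies to the
    -- reflected vector.
    have h1 : ⟪q, R.root k⟫_ℝ = 1 := by
      obtain ⟨z, hz⟩ := inner_corootSpan_weight (hmem l) (root_mem_weightLattice hR b k)
      have hz1 := (abs_le.1 (hbox k)).2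
      rw [hR.coroot_eq, inner_smul_right] at hkpos
      have hz0 := pos_of_mul_pos_right hkpos (div_pos two_pos (inner_root_self_pos R k)).le
      rw [← hq] at hz
      rw [hz] at hz0 hz1 ⊢
      have : z = 1 := le_antisymm (by exact_mod_cast hz1) (by exact_mod_cast hz0)
      simp [this]
    have h2 : R.reflection k q = q - R.coroot k := by rw [hR.reflection_apply', h1, one_smul]
    obtain ⟨s, t, rfl⟩ := List.append_of_mem hk
    have h3 : ((s ++ t).map R.coroot).sum = R.reflection k q := by
      rw [h2, hq]
      simp only [List.map_append, List.sum_append, List.map_cons, List.sum_cons]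
      abel
    have h4 := ih (s ++ t) (by simp at hl ⊢; omega) (by
      rw [h3]
      exact reflection_mem_rootBox hR hbox k)
    rw [h3] at h4
    exact hne ((R.reflection k).map_eq_zero_iff.1 h4)

end Domain

end EOrbit

namespace EOrbit

set_option linter.unusedSectionVars false

variable {ι E : Type*} [NormedAddCommGroup E] [InnerProductSpace ℝ E] {R : RootPairing ι ℝ E E}
variable [Finite ι] [FiniteDimensional ℝ E] [R.IsRootSystem] [R.IsCrystallographic] [R.IsReduced]

/-! ### The root box is a fundamental domain for the coroot lattice -/

/-- Subtract a lattice point nearest to `x`. It is no farther than its neighbours at distance one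
coroot, and squaring this comparison gives exactly the bound by 1 on each root. -/
theorem exists_add_mem_rootBox (hR : IsEuclidean R) (b : R.Base) (x : E) :
    ∃ q : corootSpan b, (q : E) + x ∈ rootBox R := by
  have hcl : IsClosed ((corootSpan b).toAddSubgroup : Set E) := AddSubgroup.isClosed_of_discrete
  obtain ⟨q, hq, hmin⟩ := hcl.exists_infDist_eq_dist ⟨0, zero_mem _⟩ x
  have key : ∀ p ∈ corootSpan b, ‖x - q‖ ≤ ‖x - p‖ := by
    intro p hp
    rw [← dist_eq_norm, ← dist_eq_norm, ← hmin]
    exact Metric.infDist_le_dist_of_mem hp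
  have key2 : ∀ i, -1 ≤ ⟪x - q, R.root i⟫_ℝ := by
    intro i
    have h := key (q - R.coroot i) (sub_mem hq (coroot_mem_corootSpan b i))
    rw [sub_sub_eq_add_sub, add_sub_right_comm] at h
    have h2 := mul_self_le_mul_self (norm_nonneg _) h
    rw [← real_inner_self_eq_norm_mul_norm, ← real_inner_self_eq_norm_mul_norm,
      real_inner_add_add_self, hR.coroot_eq] at h2
    simp only [real_inner_smul_left, real_inner_smul_right] at h2
    have hpos := inner_root_self_pos R i
    have h3 : 0 ≤ (4 / ⟪R.root i, R.root i⟫_ℝ) * (⟪x - q, R.root i⟫_ℝ + 1) := by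
      have : 2 / ⟪R.root i, R.root i⟫_ℝ * (2 / ⟪R.root i, R.root i⟫_ℝ * ⟪R.root i, R.root i⟫_ℝ) =
          4 / ⟪R.root i, R.root i⟫_ℝ := by field_simp; norm_num
      rw [this] at h2
      have h4 : 2 * (2 / ⟪R.root i, R.root i⟫_ℝ * ⟪x - q, R.root i⟫_ℝ) =
        4 / ⟪R.root i, R.root i⟫_ℝ * ⟪x - q, R.root i⟫_ℝ := by ring
      rw [h4] at h2
      linarith
    have := nonneg_of_mul_nonneg_right h3 (by positivity)
    linarith
  refine ⟨⟨-q, neg_mem hq⟩, fun i => ?_⟩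
  rw [neg_add_eq_sub]
  refine abs_le.2 ⟨key2 i, ?_⟩
  have := key2 (R.reflectionPerm i i)
  rw [root_reflectionPerm_self_eq_neg, inner_neg_right] at this
  linarith

/-! ### Haar measure and null sets of walls -/

variable [MeasurableSpace E] [BorelSpace E]

instance isAddHaarMeasure_torusMeasure (b : R.Base) : (torusMeasure b).IsAddHaarMeasure := by
  unfold torusMeasure; infer_instance

instance vaddInvariantMeasure_corootSpan (b : R.Base) :
    VAddInvariantMeasure (corootSpan b) E (torusMeasure b) :=
  ⟨fun q s _ => measure_preimage_add (torusMeasure b) (q : E) s⟩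

theorem measurePreserving_weylGroup (b : R.Base) {w : E ≃ₗ[ℝ] E} (hw : w ∈ weylGroup b) :
    MeasurePreserving w (torusMeasure b) (torusMeasure b) := by
  refine ⟨(LinearMap.continuous_of_finiteDimensional (w : E →ₗ[ℝ] E)).measurable, ?_⟩
  have hdet : |(LinearMap.det (w : E →ₗ[ℝ] E))⁻¹| = 1 ∧ LinearMap.det (w : E →ₗ[ℝ] E) ≠ 0 := by
    rw [← LinearEquiv.coe_det]
    rcases det_weylGroup b hw with h | h <;> simp [h]
  have := Measure.map_linearMap_addHaar_eq_smul_addHaar (torusMeasure b) hdet.2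
  rw [hdet.1] at this
  simpa using this

theorem torusMeasure_hyperplane (b : R.Base) (i : ι) (c : ℝ) :
    torusMeasure b {x | ⟪x, R.root i⟫_ℝ = c} = 0 := by
  let K : Submodule ℝ E := LinearMap.ker (innerₛₗ ℝ (R.root i) : E →ₗ[ℝ] ℝ)
  have hK : K ≠ ⊤ := by
    intro h
    have : R.root i ∈ K := h ▸ Submodule.mem_top
    rw [LinearMap.mem_ker, innerₛₗ_apply_apply] at this
    exact (inner_root_self_pos R i).ne' this
  have h0 := Measure.addHaar_submodule (torusMeasure b) K hK
  let v := (c / ⟪R.root i, R.root i⟫_ℝ) • R.root i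
  have hset : {x | ⟪x, R.root i⟫_ℝ = c} = (fun x => -v + x) ⁻¹' (K : Set E) := by
    ext x
    have hpos := (inner_root_self_pos R i).ne'
    simp only [Set.mem_ofPred_eq, Set.mem_preimage, SetLike.mem_coe, K, LinearMap.mem_ker,
      innerₛₗ_apply_apply, inner_add_right, inner_neg_right, v, inner_smul_right]
    rw [div_mul_cancel₀ _ hpos, real_inner_comm, neg_add_eq_zero, eq_comm]
  rw [hset, measure_preimage_add]
  exact h0

/-- Points on which no root takes the value `0` or `±1`. -/
def IsRegularPoint (R : RootPairing ι ℝ E E) (x : E) : Prop :=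
  ∀ i, ⟪x, R.root i⟫_ℝ ≠ 0 ∧ |⟪x, R.root i⟫_ℝ| ≠ 1

theorem ae_isRegularPoint (b : R.Base) : ∀ᵐ x ∂(torusMeasure b), IsRegularPoint R x := by
  refine ae_all_iff.2 fun i => ?_
  have h : ∀ c, ∀ᵐ x ∂(torusMeasure b), ⟪x, R.root i⟫_ℝ ≠ c := fun c => by
    rw [ae_iff]
    simpa using torusMeasure_hyperplane b i c
  filter_upwards [h 0, h 1, h (-1)] with x h0 h1 h2
  refine ⟨h0, fun habs => ?_⟩
  rcases eq_or_eq_neg_of_abs_eq habs with h | h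
  exacts [h1 h, h2 h]

theorem IsRegularPoint.weylGroup (hR : IsEuclidean R) {b : R.Base} {w : E ≃ₗ[ℝ] E}
    (hw : w ∈ weylGroup b) {x : E} (hx : IsRegularPoint R x) : IsRegularPoint R (w x) := by
  intro i
  obtain ⟨j, hj⟩ := weylGroup_root b (inv_mem hw) i
  rw [inner_weylGroup_left hR b hw, hj]
  exact hx j

theorem isClosed_rootBox : IsClosed (rootBox R) := by
  have : rootBox R = ⋂ i, {x | |⟪x, R.root i⟫_ℝ| ≤ 1} := by ext; simp [rootBox]
  rw [this]
  exact isClosed_iInter fun i => isClosed_le (by fun_prop) continuous_const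

/-- A coroot lattice translation identifies no two points of the root box, if one of them is
regular. -/
theorem eq_zero_of_add_mem_rootBox (hR : IsEuclidean R) {b : R.Base} {q x : E}
    (hq : q ∈ corootSpan b) (hx : x ∈ rootBox R) (hreg : IsRegularPoint R x)
    (hqx : q + x ∈ rootBox R) : q = 0 := by
  refine eq_zero_of_mem_corootSpan_of_mem_rootBox hR b hq fun i => ?_
  obtain ⟨m, hm⟩ := inner_corootSpan_weight hq (root_mem_weightLattice hR b i)
  have h1 := abs_lt.1 (lt_of_le_of_ne (hx i) (hreg i).2)
  have h2 := abs_le.1 (hqx i)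
  rw [inner_add_left, hm] at h2
  rw [hm, abs_le]
  -- Regularity makes one of the two bounds strict, so the integer `m` lies strictly between -2 and
  -- 2.
  have h3 : m < 2 := by
    have : (m : ℝ) < 2 := by linarith
    exact_mod_cast this
  have h4 : -2 < m := by
    have : (-2 : ℝ) < m := by linarith
    exact_mod_cast this
  constructor
  · have : -1 ≤ m := by omega
    exact_mod_cast this
  · have : m ≤ 1 := by omega
    exact_mod_cast this

theorem isAddFundamentalDomain_rootBox (hR : IsEuclidean R) (b : R.Base) :
    IsAddFundamentalDomain (corootSpan b) (rootBox R) (torusMeasure b) := by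
  refine IsAddFundamentalDomain.mk'' isClosed_rootBox.measurableSet.nullMeasurableSet
    (Eventually.of_forall fun x => exists_add_mem_rootBox hR b x) ?_
    fun q => (measurePreserving_vadd q (torusMeasure b)).quasiMeasurePreserving
  intro q hq
  refine measure_mono_null ?_ (ae_iff.1 (ae_isRegularPoint b))
  rintro x ⟨⟨y, hy, rfl⟩, hx⟩ hreg
  refine hq (Subtype.ext (neg_eq_zero.1 ?_))
  refine eq_zero_of_add_mem_rootBox hR (neg_mem q.2) hx hreg ?_
  change -(q : E) + ((q : E) + y) ∈ _
  rwa [neg_add_cancel_left]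

/-- Any two fundamental domains of the coroot lattice have equal measure, and the coroot
parallelepiped has measure one by normalization. -/
theorem torusMeasure_rootBox (hR : IsEuclidean R) (b : R.Base) :
    torusMeasure b (rootBox R) = 1 := by
  rw [(isAddFundamentalDomain_rootBox hR b).measure_eq
    (ZSpan.isAddFundamentalDomain b.toCoweightBasis (torusMeasure b)),
    measure_congr (ZSpan.fundamentalDomain_ae_parallelepiped _ _)]
  exact b.toCoweightBasis.addHaar_self

theorem isFiniteMeasure_restrict_rootBox (hR : IsEuclidean R) (b : R.Base) :
    IsFiniteMeasure ((torusMeasure b).restrict (rootBox R)) :=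
  ⟨by rw [Measure.restrict_apply_univ, torusMeasure_rootBox hR]; exact ENNReal.one_lt_top⟩

/-! ### Exponentials -/

/-- The exponential function `x ↦ exp (2πi⟨l, x⟩)`. -/
noncomputable def expo (l x : E) : ℂ := Complex.exp (2 * Real.pi * Complex.I * (⟪l, x⟫_ℝ : ℂ))

theorem continuous_expo (l : E) : Continuous (expo l) := by
  unfold expo; fun_prop

theorem norm_expo (l x : E) : ‖expo l x‖ = 1 := by
  have : 2 * Real.pi * Complex.I * (⟪l, x⟫_ℝ : ℂ) = ((2 * Real.pi * ⟪l, x⟫_ℝ : ℝ) : ℂ) * Complex.I := by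
    push_cast; ring
  rw [expo, this, Complex.norm_exp_ofReal_mul_I]

theorem expo_zero_left (x : E) : expo 0 x = 1 := by simp [expo]

theorem expo_add_right (l x y : E) : expo l (x + y) = expo l x * expo l y := by
  simp only [expo, ← Complex.exp_add, inner_add_right]
  push_cast; ring_nf

theorem expo_add_left (l m x : E) : expo (l + m) x = expo l x * expo m x := by
  simp only [expo, ← Complex.exp_add, inner_add_left]
  push_cast; ring_nf

theorem conj_expo (l x : E) : conj (expo l x) = expo (-l) x := by
  simp only [expo, ← Complex.exp_conj, map_mul, Complex.conj_I, Complex.conj_ofReal, inner_neg_left,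
    map_ofNat]
  push_cast; ring_nf

theorem expo_corootSpan {b : R.Base} {l q : E} (hl : l ∈ weightLattice b) (hq : q ∈ corootSpan b) :
    expo l q = 1 := by
  obtain ⟨m, hm⟩ := inner_corootSpan_weight hq hl
  rw [expo, real_inner_comm, hm, Complex.exp_eq_one_iff]
  exact ⟨m, by push_cast; ring⟩

open scoped Classical Pointwise in
theorem setIntegral_rootBox_expo (hR : IsEuclidean R) {b : R.Base} {l : E}
    (hl : l ∈ weightLattice b) :
    ∫ x in rootBox R, expo l x ∂(torusMeasure b) = if l = 0 then 1 else 0 := by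
  split_ifs with h
  · simp [h, expo_zero_left, torusMeasure_rootBox hR, Measure.real]
  have hfd := isAddFundamentalDomain_rootBox hR b
  -- Translation by `v` changes the sign of the exponential, while the translated box is again a
  -- fundamental domain; so the integral equals its own negative.
  let v : E := (1 / (2 * ⟪l, l⟫_ℝ)) • l
  have hv : expo l v = -1 := by
    have : ⟪l, v⟫_ℝ = 1 / 2 := by
      have := (real_inner_self_pos.2 h).ne'
      rw [inner_smul_right]; field_simp
    rw [expo, this, ← Complex.exp_pi_mul_I]
    push_cast; ring_nf
  have h1 := (hfd.vadd_of_comm v).setIntegral_eq hfd (f := expo l) fun q x => by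
    rw [Submodule.vadd_def, vadd_eq_add, expo_add_right, expo_corootSpan hl q.2, one_mul]
  have h2 : ∫ x in v +ᵥ rootBox R, expo l x ∂(torusMeasure b) =
      expo l v * ∫ x in rootBox R, expo l x ∂(torusMeasure b) := by
    rw [← integral_const_mul]
    simp_rw [← expo_add_right]
    exact (measurePreserving_add_left (torusMeasure b) v).setIntegral_image_emb
      (measurableEmbedding_addLeft v) _ _
  rw [h2, hv] at h1
  linear_combination (-1 / 2 : ℂ) * h1

/-! ### Integrals over the even domain -/

instance finite_evenWeylGroup (b : R.Base) : Finite (evenWeylGroup b) :=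
  have := finite_weylGroup b
  Finite.of_injective (Subgroup.inclusion (inf_le_left : evenWeylGroup b ≤ weylGroup b))
    (Subgroup.inclusion_injective _)

noncomputable instance fintype_evenWeylGroup (b : R.Base) : Fintype (evenWeylGroup b) :=
  Fintype.ofFinite _

theorem evenWeylGroup_le (b : R.Base) : evenWeylGroup b ≤ weylGroup b := inf_le_left

theorem rootBox_eq_iUnion (hR : IsEuclidean R) {b : R.Base} {θ : ι}
    (hθ : IsHighestRoot b θ) (a : ι) :
    rootBox R = ⋃ w : evenWeylGroup b,
      (w : E ≃ₗ[ℝ] E) ⁻¹' closure (evenAffineDomain b θ a) := by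
  ext x
  simp only [Set.mem_iUnion, Set.mem_preimage]
  constructor
  · intro hx
    obtain ⟨w, hw, h⟩ := exists_even_mem_closure hR hθ a hx
    exact ⟨⟨w, hw⟩, h⟩
  · rintro ⟨w, hw⟩
    have := weylGroup_mem_rootBox hR b (inv_mem (evenWeylGroup_le b w.2))
      (closure_evenAffineDomain_subset hR hθ a hw)
    exact (LinearEquiv.symm_apply_apply (w : E ≃ₗ[ℝ] E) x) ▸ this

/-- The copies of the even domain overlap only in non-regular points, which form a null set, and
each copy is moved back by a measure-preserving element. -/
theorem setIntegral_rootBox (hR : IsEuclidean R) {b : R.Base} {θ : ι}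
    (hθ : IsHighestRoot b θ) (a : ι) {h : E → ℂ}
    (hi : IntegrableOn h (rootBox R) (torusMeasure b)) :
    ∫ x in rootBox R, h x ∂(torusMeasure b) =
      ∑ w : evenWeylGroup b, ∫ x, h ((w : E ≃ₗ[ℝ] E) x) ∂(domainMeasure b θ a) := by
  have hmeas : ∀ w : evenWeylGroup b, MeasurableEmbedding (w : E ≃ₗ[ℝ] E) := fun w =>
    (w : E ≃ₗ[ℝ] E).toContinuousLinearEquiv.toHomeomorph.measurableEmbedding
  have hu := rootBox_eq_iUnion hR hθ a
  rw [hu] at hi ⊢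
  rw [integral_iUnion_ae _ _ hi, tsum_fintype, ← Equiv.sum_comp (Equiv.inv (evenWeylGroup b))]
  · refine Finset.sum_congr rfl fun w _ => ?_
    have := (measurePreserving_weylGroup b (evenWeylGroup_le b w⁻¹.2)).setIntegral_preimage_emb
      (hmeas w⁻¹) (fun x => h ((w : E ≃ₗ[ℝ] E) x)) (closure (evenAffineDomain b θ a))
    rw [domainMeasure, ← this]
    refine integral_congr_ae (Eventually.of_forall fun x => ?_)
    exact congrArg h ((LinearEquiv.apply_symm_apply (w : E ≃ₗ[ℝ] E) x).symm)
  · exact fun w => ((hmeas w).measurable isClosed_closure.measurableSet).nullMeasurableSet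
  · intro w w' hne
    refine measure_mono_null ?_ (ae_iff.1 (ae_isRegularPoint b))
    rintro x ⟨hx, hx'⟩ hreg
    apply hne
    have h1 := even_eq_one_of_regular hR hx
      (fun i => (hreg.weylGroup hR (evenWeylGroup_le b w.2) i).1) (w' * w⁻¹).2 (by
        have : ((w' * w⁻¹ : evenWeylGroup b) : E ≃ₗ[ℝ] E) ((w : E ≃ₗ[ℝ] E) x) =
            (w' : E ≃ₗ[ℝ] E) x :=
          congrArg (w' : E ≃ₗ[ℝ] E) (LinearEquiv.symm_apply_apply (w : E ≃ₗ[ℝ] E) x)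
        rw [this]
        exact hx')
    have h2 : w' * w⁻¹ = 1 := Subtype.ext h1
    exact (mul_inv_eq_one.1 h2).symm

theorem isFiniteMeasure_domainMeasure (hR : IsEuclidean R) {b : R.Base} {θ : ι}
    (hθ : IsHighestRoot b θ) (a : ι) : IsFiniteMeasure (domainMeasure b θ a) := by
  refine ⟨?_⟩
  rw [domainMeasure, Measure.restrict_apply_univ]
  refine (measure_mono (closure_evenAffineDomain_subset hR hθ a)).trans_lt ?_
  rw [torusMeasure_rootBox hR]
  exact ENNReal.one_lt_top

theorem integrable_expo (l : E) (ν : Measure E) [IsFiniteMeasure ν] : Integrable (expo l) ν :=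
  (integrable_const (1 : ℝ)).mono' (continuous_expo l).aestronglyMeasurable
    (Eventually.of_forall fun x => (norm_expo l x).le)

theorem normalizedOrbitFunction_eq_sum (b : R.Base) (l x : E) :
    normalizedOrbitFunction b l x = ∑ w : evenWeylGroup b, expo ((w : E ≃ₗ[ℝ] E) l) x :=
  finsum_eq_sum_of_fintype _

theorem integrable_normalizedOrbitFunction (b : R.Base) (l : E) (ν : Measure E)
    [IsFiniteMeasure ν] : Integrable (normalizedOrbitFunction b l) ν := by
  rw [funext (normalizedOrbitFunction_eq_sum b l)]
  exact integrable_finsetSum _ fun w _ => integrable_expo _ _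

theorem expo_weylGroup (hR : IsEuclidean R) {b : R.Base} {w : E ≃ₗ[ℝ] E} (hw : w ∈ weylGroup b)
    (l x : E) : expo (w l) x = expo l (w⁻¹ x) := by
  rw [expo, expo, inner_weylGroup_left hR b hw]

open scoped Classical in
theorem integral_normalizedOrbitFunction (hR : IsEuclidean R) {b : R.Base} {θ : ι}
    (hθ : IsHighestRoot b θ) (a : ι) {l : E} (hl : l ∈ weightLattice b) :
    ∫ x, normalizedOrbitFunction b l x ∂(domainMeasure b θ a) = if l = 0 then 1 else 0 := by
  have := isFiniteMeasure_domainMeasure hR hθ a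
  have := isFiniteMeasure_restrict_rootBox hR b
  rw [← setIntegral_rootBox_expo hR hl, setIntegral_rootBox hR hθ a (integrable_expo l _),
    ← Equiv.sum_comp (Equiv.inv (evenWeylGroup b))]
  simp_rw [normalizedOrbitFunction_eq_sum]
  rw [integral_finsetSum _ fun w _ => integrable_expo _ _]
  refine Finset.sum_congr rfl fun w _ => integral_congr_ae (Eventually.of_forall fun x => ?_)
  exact expo_weylGroup hR (evenWeylGroup_le b w.2) l x

theorem normalizedOrbitFunction_mul_conj (b : R.Base) (l m x : E) :
    normalizedOrbitFunction b l x * conj (normalizedOrbitFunction b m x) =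
      ∑ u : evenWeylGroup b, normalizedOrbitFunction b (l - (u : E ≃ₗ[ℝ] E) m) x := by
  simp_rw [normalizedOrbitFunction_eq_sum, map_sum, conj_expo, Finset.sum_mul_sum]
  rw [Finset.sum_comm (s := (Finset.univ : Finset (evenWeylGroup b)))]
  rw [Finset.sum_comm]
  conv_rhs => rw [Finset.sum_comm]
  refine Finset.sum_congr rfl fun w _ => ?_
  -- Substituting `w u` for the second group element gives the exponent `w (l - u m)`.
  rw [← Equiv.sum_comp (Equiv.mulLeft w)]
  refine Finset.sum_congr rfl fun u _ => ?_
  rw [← expo_add_left, map_sub, sub_eq_add_neg]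
  rfl

theorem integral_normalizedOrbitFunction_mul_conj (hR : IsEuclidean R) {b : R.Base} {θ : ι}
    (hθ : IsHighestRoot b θ) (a : ι) {l m : E} (hl : l ∈ weightLattice b)
    (hm : m ∈ weightLattice b) :
    ∫ x, normalizedOrbitFunction b l x * conj (normalizedOrbitFunction b m x)
        ∂(domainMeasure b θ a) =
      (Nat.card {u : evenWeylGroup b // (u : E ≃ₗ[ℝ] E) m = l} : ℂ) := by
  classical
  have := isFiniteMeasure_domainMeasure hR hθ a
  simp_rw [normalizedOrbitFunction_mul_conj]
  rw [integral_finsetSum]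
  · rw [Finset.sum_congr rfl fun u _ => integral_normalizedOrbitFunction hR hθ a
      (weightLattice_sub hl (weightLattice_weylGroup hR (evenWeylGroup_le b u.2) hm))]
    simp_rw [sub_eq_zero, eq_comm (a := l)]
    rw [Nat.card_eq_fintype_card, Fintype.card_subtype, Finset.sum_boole]
  · exact fun u _ => integrable_normalizedOrbitFunction b _ _

/-! ### Orbit functions -/

/-- Each orbit point is hit once for every element of a coset of the stabilizer. -/
theorem normalizedOrbitFunction_eq_stabCard_mul (b : R.Base) (l x : E) :
    normalizedOrbitFunction b l x = stabCard b l * orbitFunction b l x := by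
  classical
  have horb : evenOrbit b l =
      ((Finset.univ.image fun w : evenWeylGroup b => (w : E ≃ₗ[ℝ] E) l : Finset E) : Set E) := by
    ext m
    simp [evenOrbit, MulAction.mem_orbit_iff, Subgroup.smul_def]
  rw [normalizedOrbitFunction_eq_sum, orbitFunction, horb, finsum_mem_coe_finset,
    Finset.sum_comp (fun m => expo m x), Finset.mul_sum]
  refine Finset.sum_congr rfl fun m hm => ?_
  obtain ⟨v, -, rfl⟩ := Finset.mem_image.1 hm
  rw [nsmul_eq_mul]
  congr 2
  rw [stabCard, Nat.card_eq_fintype_card, ← Fintype.card_subtype]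
  refine Fintype.card_congr ((Equiv.mulLeft v⁻¹).subtypeEquiv fun w => ?_)
  rw [MulAction.mem_stabilizer_iff, Equiv.coe_mulLeft, mul_smul, inv_smul_eq_iff]
  rfl

theorem stabCard_pos (b : R.Base) (l : E) : 0 < stabCard b l := Nat.card_pos

theorem orbitFunction_eq_inv_stabCard_mul (b : R.Base) (l x : E) :
    orbitFunction b l x = (stabCard b l : ℂ)⁻¹ * normalizedOrbitFunction b l x := by
  have : (stabCard b l : ℂ) ≠ 0 := by exact_mod_cast (stabCard_pos b l).ne'
  rw [normalizedOrbitFunction_eq_stabCard_mul, inv_mul_cancel_left₀ this]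

theorem continuous_normalizedOrbitFunction (b : R.Base) (l : E) :
    Continuous (normalizedOrbitFunction b l) := by
  rw [funext (normalizedOrbitFunction_eq_sum b l)]
  exact continuous_finsetSum _ fun w _ => continuous_expo _

theorem continuous_orbitFunction (b : R.Base) (l : E) : Continuous (orbitFunction b l) := by
  rw [funext (orbitFunction_eq_inv_stabCard_mul b l)]
  exact continuous_const.mul (continuous_normalizedOrbitFunction b l)

theorem norm_normalizedOrbitFunction_le (b : R.Base) (l x : E) :
    ‖normalizedOrbitFunction b l x‖ ≤ Nat.card (evenWeylGroup b) := by
  rw [normalizedOrbitFunction_eq_sum]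
  refine (norm_sum_le _ _).trans ?_
  simp [norm_expo]

theorem norm_orbitFunction_le (b : R.Base) (l x : E) :
    ‖orbitFunction b l x‖ ≤ (stabCard b l : ℝ)⁻¹ * Nat.card (evenWeylGroup b) := by
  rw [orbitFunction_eq_inv_stabCard_mul, norm_mul, norm_inv, Complex.norm_natCast]
  exact mul_le_mul_of_nonneg_left (norm_normalizedOrbitFunction_le b l x) (by positivity)

-- The number of `u` with `u m = l` is the stabilizer order on the diagonal. Off the diagonal it is
-- zero because the representatives in `P^e_+` are unique.
open scoped Classical in
theorem integral_orbitFunction_mul_conj (hR : IsEuclidean R) {b : R.Base} {θ : ι}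
    (hθ : IsHighestRoot b θ) (a : ι) {l m : E} (hl : l ∈ evenDominantWeights b a)
    (hm : m ∈ evenDominantWeights b a) :
    ∫ x, orbitFunction b l x * conj (orbitFunction b m x) ∂(domainMeasure b θ a) =
      if l = m then (stabCard b l : ℂ)⁻¹ else 0 := by
  have h : ∀ x, orbitFunction b l x * conj (orbitFunction b m x) =
      ((stabCard b l : ℂ)⁻¹ * (stabCard b m : ℂ)⁻¹) *
        (normalizedOrbitFunction b l x * conj (normalizedOrbitFunction b m x)) := by
    intro x
    rw [orbitFunction_eq_inv_stabCard_mul, orbitFunction_eq_inv_stabCard_mul b m]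
    simp only [map_mul, map_inv₀, Complex.conj_natCast]
    ring
  simp_rw [h]
  rw [integral_const_mul, integral_normalizedOrbitFunction_mul_conj hR hθ a
    (evenDominantWeights_subset hR b a hl) (evenDominantWeights_subset hR b a hm)]
  split_ifs with hlm
  · subst hlm
    have : (stabCard b l : ℂ) ≠ 0 := by exact_mod_cast (stabCard_pos b l).ne'
    change _ * (stabCard b l : ℂ) = _
    field_simp
  · have : IsEmpty {u : evenWeylGroup b // (u : E ≃ₗ[ℝ] E) m = l} :=
      ⟨fun ⟨u, hu⟩ => hlm (hu.symm.trans (evenDominantWeights_unique hR b a hm u.2 (hu ▸ hl)))⟩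
    simp

end EOrbit

namespace EOrbit

set_option linter.unusedSectionVars false

/-! ### Measures on a torus -/

/-- A finite measure on a torus is determined by its Fourier coefficients. -/
theorem measure_ext_mFourier {d : Type*} [Fintype d] {m₁ m₂ : Measure (UnitAddTorus d)}
    [IsFiniteMeasure m₁] [IsFiniteMeasure m₂]
    (h : ∀ n, ∫ x, UnitAddTorus.mFourier n x ∂m₁ = ∫ x, UnitAddTorus.mFourier n x ∂m₂) :
    m₁ = m₂ := by
  have hint : ∀ (m : Measure (UnitAddTorus d)) [IsFiniteMeasure m],
      ∃ L : C(UnitAddTorus d, ℂ) →L[ℂ] ℂ, ∀ F, L F = ∫ x, F x ∂m := by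
    intro m _
    have hF : ∀ F : C(UnitAddTorus d, ℂ), Integrable F m := fun F =>
      F.continuous.integrable_of_hasCompactSupport (HasCompactSupport.of_compactSpace _)
    refine ⟨LinearMap.mkContinuous
      { toFun := fun F => ∫ x, F x ∂m
        map_add' := fun F G => integral_add (hF F) (hF G)
        map_smul' := fun c F => integral_const_mul c _ } (m.real Set.univ) fun F => ?_, fun F => rfl⟩
    rw [mul_comm]
    exact norm_integral_le_of_norm_le_const (Eventually.of_forall fun x => F.norm_coe_le_norm x)
  obtain ⟨L₁, hL₁⟩ := hint m₁
  obtain ⟨L₂, hL₂⟩ := hint m₂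
  -- Trigonometric polynomials are dense among the continuous functions.
  have hL : L₁ = L₂ := by
    refine ContinuousLinearMap.ext_on (s := Set.range (UnitAddTorus.mFourier (d := d))) ?_ ?_
    · rw [Submodule.dense_iff_topologicalClosure_eq_top]
      exact UnitAddTorus.span_mFourier_closure_eq_top
    · rintro _ ⟨n, rfl⟩
      rw [hL₁, hL₂, h]
  refine ext_of_forall_integral_eq_of_IsFiniteMeasure fun f => ?_
  let F : C(UnitAddTorus d, ℂ) := ⟨fun x => (f x : ℂ), by fun_prop⟩
  have hF := (hL₁ F).symm.trans ((congrArg (· F) hL).trans (hL₂ F))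
  change ∫ x, (f x : ℂ) ∂m₁ = ∫ x, (f x : ℂ) ∂m₂ at hF
  rw [integral_complex_ofReal, integral_complex_ofReal] at hF
  exact_mod_cast hF

variable {ι E : Type*} [NormedAddCommGroup E] [InnerProductSpace ℝ E] {R : RootPairing ι ℝ E E}
variable [Finite ι] [FiniteDimensional ℝ E] [R.IsRootSystem] [R.IsCrystallographic] [R.IsReduced]

/-- The projection onto the torus `E / Q^∨` in coordinates. -/
noncomputable def torusMap (b : R.Base) (x : E) : UnitAddTorus b.support :=
  fun i => ((b.toCoweightBasis.repr x i : ℝ) : UnitAddCircle)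

theorem continuous_torusMap (b : R.Base) : Continuous (torusMap b) := by
  refine continuous_pi fun i => (AddCircle.continuous_mk' 1).comp ?_
  exact LinearMap.continuous_of_finiteDimensional (b.toCoweightBasis.coord i)

theorem sub_mem_corootSpan_of_torusMap_eq {b : R.Base} {x y : E}
    (h : torusMap b x = torusMap b y) : x - y ∈ corootSpan b := by
  refine (b.toCoweightBasis.mem_span_iff_repr_mem ℤ _).2 fun i => ?_
  have hi := congrFun h i
  rw [torusMap, torusMap, ← sub_eq_zero, ← AddCircle.coe_sub, AddCircle.coe_eq_zero_iff] at hi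
  obtain ⟨n, hn⟩ := hi
  exact ⟨n, by simpa using hn⟩

/-- The vector dual to the functional with values `n i` on the simple coroots is a weight, so every
torus character is an exponential of a weight. -/
theorem exists_weight_mFourier (b : R.Base) (n : b.support → ℤ) :
    ∃ l ∈ weightLattice b, ∀ x, UnitAddTorus.mFourier n (torusMap b x) = expo l x := by
  let φ : E →ₗ[ℝ] ℝ := b.toCoweightBasis.constr ℝ (fun i => (n i : ℝ))
  have hφ : ∀ x, ⟪(InnerProductSpace.toDual ℝ E).symm (LinearMap.toContinuousLinearMap φ), x⟫_ℝ =
      ∑ i, b.toCoweightBasis.repr x i * n i := by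
    intro x
    rw [InnerProductSpace.toDual_symm_apply]
    change φ x = _
    rw [Module.Basis.constr_apply_fintype]
    rfl
  refine ⟨(InnerProductSpace.toDual ℝ E).symm (LinearMap.toContinuousLinearMap φ), ?_, fun x => ?_⟩
  · intro i hi
    refine ⟨n ⟨i, hi⟩, ?_⟩
    rw [real_inner_comm, InnerProductSpace.toDual_symm_apply]
    have := b.toCoweightBasis.constr_basis ℝ (fun i => (n i : ℝ)) ⟨i, hi⟩
    rwa [b.toCoweightBasis_apply] at this
  · change ∏ i, fourier (n i) ((b.toCoweightBasis.repr x i : ℝ) : UnitAddCircle) = _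
    simp_rw [fourier_coe_apply]
    rw [expo, hφ, ← Complex.exp_sum]
    push_cast
    rw [Finset.mul_sum]
    refine congrArg _ (Finset.sum_congr rfl fun i _ => ?_)
    ring

/-! ### Completeness -/

variable [MeasurableSpace E] [BorelSpace E]

/-- A finite measure on the even domain which charges no wall is determined by its integrals
against the functions `Ê_l`. -/
theorem measure_ext_normalizedOrbitFunction (hR : IsEuclidean R) {b : R.Base} {θ : ι}
    (hθ : IsHighestRoot b θ) (a : ι) {ν₁ ν₂ : Measure E} [IsFiniteMeasure ν₁] [IsFiniteMeasure ν₂]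
    (h₁ : ν₁ ≪ domainMeasure b θ a) (h₂ : ν₂ ≪ domainMeasure b θ a)
    (h : ∀ l ∈ weightLattice b,
      ∫ x, normalizedOrbitFunction b l x ∂ν₁ = ∫ x, normalizedOrbitFunction b l x ∂ν₂) :
    ν₁ = ν₂ := by
  have : CompleteSpace E := FiniteDimensional.complete ℝ E
  have hcont : ∀ w : evenWeylGroup b, Continuous (fun x => torusMap b ((w : E ≃ₗ[ℝ] E) x)) :=
    fun w => (continuous_torusMap b).comp
      (LinearMap.continuous_of_finiteDimensional ((w : E ≃ₗ[ℝ] E) : E →ₗ[ℝ] E))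
  -- Summing over the group turns a Fourier coefficient on the torus into an integral of `Ê_l` on
  -- the even domain.
  let push : Measure E → Measure (UnitAddTorus b.support) := fun ν =>
    ∑ w : evenWeylGroup b, ν.map (fun x => torusMap b ((w : E ≃ₗ[ℝ] E) x))
  have hpush : ∀ (ν : Measure E) [IsFiniteMeasure ν] (n : b.support → ℤ) (l : E),
      (∀ x, UnitAddTorus.mFourier n (torusMap b x) = expo l x) →
      ∫ y, UnitAddTorus.mFourier n y ∂(push ν) = ∫ x, normalizedOrbitFunction b l x ∂ν := by
    intro ν _ n l hnl
    rw [integral_finsetSum_measure]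
    · simp_rw [normalizedOrbitFunction_eq_sum]
      rw [integral_finsetSum _ fun w _ => integrable_expo _ _,
        ← Equiv.sum_comp (Equiv.inv (evenWeylGroup b))]
      refine Finset.sum_congr rfl fun w _ => ?_
      rw [integral_map (hcont _).aemeasurable
        (UnitAddTorus.mFourier n).continuous.aestronglyMeasurable]
      refine integral_congr_ae (Eventually.of_forall fun x => ?_)
      change UnitAddTorus.mFourier n (torusMap b (((w : E ≃ₗ[ℝ] E)⁻¹) x)) = _
      rw [hnl, expo_weylGroup hR (evenWeylGroup_le b w.2)]
    · intro w _
      have : IsFiniteMeasure (ν.map (fun x => torusMap b ((w : E ≃ₗ[ℝ] E) x))) := inferInstance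
      exact (UnitAddTorus.mFourier n).continuous.integrable_of_hasCompactSupport
        (HasCompactSupport.of_compactSpace _)
  have hfin : ∀ (ν : Measure E) [IsFiniteMeasure ν], IsFiniteMeasure (push ν) := fun ν _ =>
    inferInstanceAs (IsFiniteMeasure (∑ w : evenWeylGroup b,
      ν.map (fun x => torusMap b ((w : E ≃ₗ[ℝ] E) x))))
  have heq : push ν₁ = push ν₂ := by
    have := hfin ν₁
    have := hfin ν₂
    refine measure_ext_mFourier fun n => ?_
    obtain ⟨l, hl, hnl⟩ := exists_weight_mFourier b n
    rw [hpush ν₁ n l hnl, hpush ν₂ n l hnl, h l hl]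
  let U : Set E := {x | x ∈ closure (evenAffineDomain b θ a) ∧ IsRegularPoint R x}
  have hUmeas : MeasurableSet U := by
    have : U = closure (evenAffineDomain b θ a) ∩
        ⋂ i, ({x | ⟪x, R.root i⟫_ℝ = 0}ᶜ ∩ {x | |⟪x, R.root i⟫_ℝ| = 1}ᶜ) := by
      ext x; simp [U, IsRegularPoint]
    rw [this]
    refine isClosed_closure.measurableSet.inter (MeasurableSet.iInter fun i => ?_)
    exact (isClosed_eq (by fun_prop) continuous_const).measurableSet.compl.inter
      (isClosed_eq (by fun_prop) continuous_const).measurableSet.compl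
  have hUae : ∀ᵐ x ∂(domainMeasure b θ a), x ∈ U := by
    filter_upwards [ae_restrict_mem isClosed_closure.measurableSet,
      ae_restrict_of_ae (ae_isRegularPoint b)] with x h1 h2 using ⟨h1, h2⟩
  -- Equal torus images differ by a coroot lattice vector, which vanishes because both points lie in
  -- the box and `y` is regular; then `w` is trivial.
  have hUsep : ∀ x ∈ U, ∀ y ∈ U, ∀ w : evenWeylGroup b,
      torusMap b ((w : E ≃ₗ[ℝ] E) x) = torusMap b y → w = 1 ∧ x = y := by
    intro x hx y hy w hw
    have hww := evenWeylGroup_le b w.2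
    have hq := sub_mem_corootSpan_of_torusMap_eq hw
    have h0 := eq_zero_of_add_mem_rootBox hR hq (closure_evenAffineDomain_subset hR hθ a hy.1)
      hy.2 (by
        rw [sub_add_cancel]
        exact weylGroup_mem_rootBox hR b hww (closure_evenAffineDomain_subset hR hθ a hx.1))
    rw [sub_eq_zero] at h0
    have h1 : w = 1 := Subtype.ext
      (even_eq_one_of_regular hR hx.1 (fun i => (hx.2 i).1) w.2 (h0 ▸ hy.1))
    subst h1
    exact ⟨rfl, h0⟩
  have hval : ∀ (ν : Measure E), ν ≪ domainMeasure b θ a → ∀ s, MeasurableSet s → s ⊆ U →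
      push ν (torusMap b '' s) = ν s := by
    intro ν hν s hs hsU
    have hinj : Set.InjOn (torusMap b) s := fun x hx y hy hxy =>
      (hUsep x (hsU hx) y (hsU hy) 1 hxy).2
    -- Injective continuous images of Borel sets are Borel. In the sum evaluated below, only the
    -- identity contributes.
    have himg : MeasurableSet (torusMap b '' s) :=
      hs.image_of_continuousOn_injOn (continuous_torusMap b).continuousOn hinj
    have hν0 : ν Uᶜ = 0 := hν (ae_iff.1 hUae)
    rw [Measure.finsetSum_apply, Finset.sum_eq_single 1]
    · rw [Measure.map_apply (hcont 1).measurable himg]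
      refine measure_congr ?_
      filter_upwards [(ae_iff.2 hν0 : ∀ᵐ x ∂ν, x ∈ U)] with x hx
      refine propext ⟨?_, fun hxs => ⟨x, hxs, rfl⟩⟩
      rintro ⟨y, hy, hyx⟩
      exact (hUsep x hx y (hsU hy) 1 hyx.symm).2 ▸ hy
    · intro w _ hw
      rw [Measure.map_apply (hcont w).measurable himg]
      refine measure_mono_null ?_ hν0
      rintro x ⟨y, hy, hyx⟩ hx
      exact hw (hUsep x hx y (hsU hy) w hyx.symm).1
    · simp
  ext s hs
  have hinter : ∀ (ν : Measure E), ν ≪ domainMeasure b θ a → ν s = ν (s ∩ U) := by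
    intro ν hν
    refine measure_congr ?_
    filter_upwards [hν.ae_le hUae] with x hx
    exact propext ⟨fun h => ⟨h, hx⟩, fun h => h.1⟩
  rw [hinter ν₁ h₁, hinter ν₂ h₂, ← hval ν₁ h₁ _ (hs.inter hUmeas) Set.inter_subset_right,
    ← hval ν₂ h₂ _ (hs.inter hUmeas) Set.inter_subset_right, heq]

theorem integrable_mul_normalizedOrbitFunction (b : R.Base) (l : E) {ν : Measure E} {f : E → ℂ}
    (hf : Integrable f ν) : Integrable (fun x => f x * normalizedOrbitFunction b l x) ν :=
  hf.mul_bdd (continuous_normalizedOrbitFunction b l).aestronglyMeasurable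
    (Eventually.of_forall fun x => norm_normalizedOrbitFunction_le b l x)

/-- The positive and negative parts of `g` are densities of two finite measures with the same
integrals against all `Ê_l`; these coincide, so the parts agree almost everywhere. -/
theorem ae_eq_zero_of_real (hR : IsEuclidean R) {b : R.Base} {θ : ι}
    (hθ : IsHighestRoot b θ) (a : ι) {g : E → ℝ} (hg : Integrable g (domainMeasure b θ a))
    (h : ∀ l ∈ weightLattice b,
      ∫ x, (g x : ℂ) * normalizedOrbitFunction b l x ∂(domainMeasure b θ a) = 0) :
    g =ᵐ[domainMeasure b θ a] 0 := by
  set ν := domainMeasure b θ a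
  have hm : ∀ {k : E → ℝ}, Integrable k ν → AEMeasurable (fun x => ENNReal.ofReal (k x)) ν :=
    fun hk => hk.aestronglyMeasurable.aemeasurable.ennreal_ofReal
  have hlt : ∀ {k : E → ℝ}, Integrable k ν → ∫⁻ x, ENNReal.ofReal (k x) ∂ν ≠ ∞ :=
    fun {k} hk => hk.lintegral_lt_top.ne
  have hint : ∀ {k : E → ℝ}, Integrable k ν → ∀ l,
      ∫ x, normalizedOrbitFunction b l x ∂(ν.withDensity fun x => ENNReal.ofReal (k x)) =
        ∫ x, ((max (k x) 0 : ℝ) : ℂ) * normalizedOrbitFunction b l x ∂ν := by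
    intro k hk l
    rw [integral_withDensity_eq_integral_toReal_smul₀ (hm hk)
      (Eventually.of_forall fun x => ENNReal.ofReal_lt_top)]
    refine integral_congr_ae (Eventually.of_forall fun x => ?_)
    simp only [ENNReal.toReal_ofReal', Complex.real_smul]
  have hfin : ∀ {k : E → ℝ}, Integrable k ν →
      IsFiniteMeasure (ν.withDensity fun x => ENNReal.ofReal (k x)) :=
    fun hk => isFiniteMeasure_withDensity (hlt hk)
  have hpos : ∀ {k : E → ℝ}, Integrable k ν → ∀ l,
      Integrable (fun x => ((max (k x) 0 : ℝ) : ℂ) * normalizedOrbitFunction b l x) ν :=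
    fun hk l => integrable_mul_normalizedOrbitFunction b l hk.pos_part.ofReal
  have := hfin hg
  have := hfin hg.neg
  have heq := measure_ext_normalizedOrbitFunction hR hθ a
    (withDensity_absolutelyContinuous ν fun x => ENNReal.ofReal (g x))
    (withDensity_absolutelyContinuous ν fun x => ENNReal.ofReal ((-g) x)) (by
      intro l hl
      rw [hint hg, hint hg.neg, ← sub_eq_zero, ← integral_sub (hpos hg l) (hpos hg.neg l), ← h l hl]
      refine integral_congr_ae (Eventually.of_forall fun x => ?_)
      simp only [Pi.neg_apply]
      rw [← sub_mul, ← Complex.ofReal_sub]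
      congr 2
      rcases le_total (g x) 0 with hx | hx
      · rw [max_eq_right hx, max_eq_left (by linarith)]; ring
      · rw [max_eq_left hx, max_eq_right (by linarith)]; ring)
  rw [withDensity_eq_iff (hm hg) (hm hg.neg) (hlt hg)] at heq
  filter_upwards [heq] with x hx
  have h1 := congrArg ENNReal.toReal hx
  simp only [ENNReal.toReal_ofReal', Pi.neg_apply] at h1
  change g x = 0
  rcases le_total (g x) 0 with h2 | h2
  · rw [max_eq_right h2, max_eq_left (by linarith)] at h1; linarith
  · rw [max_eq_left h2, max_eq_right (by linarith)] at h1; linarith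

theorem conj_normalizedOrbitFunction (b : R.Base) (l x : E) :
    conj (normalizedOrbitFunction b l x) = normalizedOrbitFunction b (-l) x := by
  simp_rw [normalizedOrbitFunction_eq_sum, map_sum, conj_expo, map_neg]

/-- The functions `Ê_l` are complete on the even domain. -/
theorem ae_eq_zero_of_integral_normalizedOrbitFunction (hR : IsEuclidean R) {b : R.Base} {θ : ι}
    (hθ : IsHighestRoot b θ) (a : ι) {f : E → ℂ} (hf : Integrable f (domainMeasure b θ a))
    (h : ∀ l ∈ weightLattice b,
      ∫ x, f x * normalizedOrbitFunction b l x ∂(domainMeasure b θ a) = 0) :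
    f =ᵐ[domainMeasure b θ a] 0 := by
  have hfc : Integrable (fun x => conj (f x)) (domainMeasure b θ a) :=
    hf.congr' ((Complex.continuous_conj.comp_aestronglyMeasurable hf.1))
      (Eventually.of_forall fun x => by simp)
  -- Conjugation replaces `l` by `-l`, again a weight, so the hypothesis passes to the conjugate of
  -- `f` and hence to the real and imaginary parts.
  have hc : ∀ l ∈ weightLattice b,
      ∫ x, conj (f x) * normalizedOrbitFunction b l x ∂(domainMeasure b θ a) = 0 := by
    intro l hl
    have h1 := h (-l) (weightLattice_neg hl)
    have h2 := congrArg conj h1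
    rw [← integral_conj, map_zero] at h2
    simpa only [map_mul, conj_normalizedOrbitFunction, neg_neg] using h2
  have hre := ae_eq_zero_of_real hR hθ a hf.re fun l hl => by
    have : ∀ x, ((RCLike.re (f x) : ℝ) : ℂ) * normalizedOrbitFunction b l x =
        (1 / 2) * (f x * normalizedOrbitFunction b l x +
          conj (f x) * normalizedOrbitFunction b l x) := by
      intro x
      have := Complex.re_eq_add_conj (f x)
      change ((f x).re : ℂ) * _ = _
      rw [this]; ring
    simp_rw [this]
    rw [integral_const_mul, integral_add (integrable_mul_normalizedOrbitFunction b l hf)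
      (integrable_mul_normalizedOrbitFunction b l hfc), h l hl, hc l hl]
    simp
  have him := ae_eq_zero_of_real hR hθ a hf.im fun l hl => by
    have : ∀ x, ((RCLike.im (f x) : ℝ) : ℂ) * normalizedOrbitFunction b l x =
        (1 / (2 * Complex.I)) * (f x * normalizedOrbitFunction b l x -
          conj (f x) * normalizedOrbitFunction b l x) := by
      intro x
      have := Complex.im_eq_sub_conj (f x)
      change ((f x).im : ℂ) * _ = _
      rw [this]; ring
    simp_rw [this]
    rw [integral_const_mul, integral_sub (integrable_mul_normalizedOrbitFunction b l hf)
      (integrable_mul_normalizedOrbitFunction b l hfc), h l hl, hc l hl]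
    simp
  filter_upwards [hre, him] with x h1 h2
  exact Complex.ext h1 h2

theorem normalizedOrbitFunction_weylGroup (b : R.Base) (w : evenWeylGroup b) (l x : E) :
    normalizedOrbitFunction b ((w : E ≃ₗ[ℝ] E) l) x = normalizedOrbitFunction b l x := by
  rw [normalizedOrbitFunction_eq_sum, normalizedOrbitFunction_eq_sum,
    ← Equiv.sum_comp (Equiv.mulRight w) fun v => expo ((v : E ≃ₗ[ℝ] E) l) x]
  rfl

/-- The orbit functions `E_l` are complete on the even domain. -/
theorem ae_eq_zero_of_integral_orbitFunction (hR : IsEuclidean R) {b : R.Base} {θ : ι}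
    (hθ : IsHighestRoot b θ) (a : ι) {f : E → ℂ} (hf : Integrable f (domainMeasure b θ a))
    (h : ∀ l ∈ evenDominantWeights b a,
      ∫ x, f x * orbitFunction b l x ∂(domainMeasure b θ a) = 0) :
    f =ᵐ[domainMeasure b θ a] 0 := by
  refine ae_eq_zero_of_integral_normalizedOrbitFunction hR hθ a hf fun l hl => ?_
  obtain ⟨w, hw, hwl⟩ := exists_even_mem_evenDominantWeights hR b a hl
  have : ∀ x, f x * normalizedOrbitFunction b l x =
      stabCard b (w l) * (f x * orbitFunction b (w l) x) := by
    intro x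
    rw [← normalizedOrbitFunction_weylGroup b ⟨w, hw⟩, normalizedOrbitFunction_eq_stabCard_mul]
    ring
  simp_rw [this]
  rw [integral_const_mul, h _ hwl, mul_zero]

end EOrbit

namespace EOrbit

set_option linter.unusedSectionVars false

/-! ### Orthogonal bases -/

section Hilbert

variable {κ H : Type*} [NormedAddCommGroup H] [InnerProductSpace ℂ H] [CompleteSpace H]

theorem topologicalClosure_span_eq_top_of_complete {v : κ → H}
    (hc : ∀ f, (∀ k, ⟪v k, f⟫_ℂ = 0) → f = 0) :
    (Submodule.span ℂ (Set.range v)).topologicalClosure = ⊤ := by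
  rw [Submodule.topologicalClosure_eq_top_iff, Submodule.eq_bot_iff]
  intro f hf
  refine hc f fun k => ?_
  exact (Submodule.mem_orthogonal _ f).1 hf _ (Submodule.subset_span ⟨k, rfl⟩)

/-- Expansion with respect to a complete orthogonal family with squared norms `(r k)⁻¹`. -/
theorem hasSum_of_orthogonal_complete {v : κ → H} {r : κ → ℝ} (hr : ∀ k, 0 < r k)
    (hself : ∀ k, ⟪v k, v k⟫_ℂ = ((r k : ℂ))⁻¹) (horth : ∀ k l, k ≠ l → ⟪v k, v l⟫_ℂ = 0)
    (hc : ∀ f, (∀ k, ⟪v k, f⟫_ℂ = 0) → f = 0) (f : H) :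
    HasSum (fun k => ((r k : ℂ) * ⟪v k, f⟫_ℂ) • v k) f ∧
      HasSum (fun k => r k * ‖⟪v k, f⟫_ℂ‖ ^ 2) (‖f‖ ^ 2) := by
  classical
  have hs : ∀ k, ((√(r k) : ℝ) : ℂ) * ((√(r k) : ℝ) : ℂ) = (r k : ℂ) := fun k => by
    rw [← Complex.ofReal_mul, Real.mul_self_sqrt (hr k).le]
  -- The squared norm of `v k` is `(r k)⁻¹`, so this factor normalizes the family and a Hilbert
  -- basis results.
  let u : κ → H := fun k => ((√(r k) : ℝ) : ℂ) • v k
  have hu : Orthonormal ℂ u := by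
    rw [orthonormal_iff_ite]
    intro k l
    simp only [u, inner_smul_left, inner_smul_right, Complex.conj_ofReal]
    split_ifs with h
    · subst h
      have : (r k : ℂ) ≠ 0 := by exact_mod_cast (hr k).ne'
      rw [hself, ← mul_assoc, hs, mul_inv_cancel₀ this]
    · rw [horth k l h]; simp
  have huc : (Submodule.span ℂ (Set.range u))ᗮ = ⊥ := by
    rw [← Submodule.topologicalClosure_eq_top_iff]
    refine topologicalClosure_span_eq_top_of_complete fun g hg => hc g fun k => ?_
    have := hg k
    simp only [u, inner_smul_left, Complex.conj_ofReal] at this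
    refine (mul_eq_zero.1 this).resolve_left ?_
    exact_mod_cast (Real.sqrt_pos.2 (hr k)).ne'
  let B := HilbertBasis.mkOfOrthogonalEqBot hu huc
  have hB : ∀ k, B k = u k := fun k =>
    congrFun (HilbertBasis.coe_mkOfOrthogonalEqBot hu huc) k
  constructor
  · convert B.hasSum_repr f using 2 with k
    rw [B.repr_apply_apply, hB]
    simp only [u, inner_smul_left, Complex.conj_ofReal, smul_smul]
    rw [mul_right_comm, hs]
  · have hnorm : ((‖f‖ ^ 2 : ℝ) : ℂ) = ⟪f, f⟫_ℂ := by
      rw [inner_self_eq_norm_sq_to_K]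
      push_cast; rfl
    have hterm : ∀ k, ((r k * ‖⟪v k, f⟫_ℂ‖ ^ 2 : ℝ) : ℂ) = ⟪f, B k⟫_ℂ * ⟪B k, f⟫_ℂ := by
      intro k
      rw [← inner_conj_symm f (B k), hB]
      simp only [u, inner_smul_left, Complex.conj_ofReal, map_mul]
      rw [mul_mul_mul_comm, hs, Complex.conj_mul']
      push_cast; rfl
    rw [← Complex.hasSum_ofReal, hnorm]
    simp_rw [hterm]
    exact B.hasSum_inner_mul_inner f f

end Hilbert

/-! ### The orbit functions in `L²` -/

section

variable {ι E : Type*} [NormedAddCommGroup E] [InnerProductSpace ℝ E] {R : RootPairing ι ℝ E E}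
variable [Finite ι] [FiniteDimensional ℝ E] [R.IsRootSystem] [R.IsCrystallographic] [R.IsReduced]
variable [MeasurableSpace E] [BorelSpace E]

theorem memLp_orbitFunction (hR : IsEuclidean R) {b : R.Base} {θ : ι}
    (hθ : IsHighestRoot b θ) (a : ι) (l : E) :
    MemLp (orbitFunction b l) 2 (domainMeasure b θ a) :=
  have := isFiniteMeasure_domainMeasure hR hθ a
  MemLp.of_bound (continuous_orbitFunction b l).aestronglyMeasurable _
    (Eventually.of_forall fun x => norm_orbitFunction_le b l x)

theorem memLp_conj {ν : Measure E} {f : E → ℂ} (hf : MemLp f 2 ν) :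
    MemLp (fun x => conj (f x)) 2 ν :=
  hf.congr_norm (Complex.continuous_conj.comp_aestronglyMeasurable hf.1)
    (Eventually.of_forall fun x => by simp)

theorem inner_toLp {ν : Measure E} {f g : E → ℂ} (hf : MemLp f 2 ν) (hg : MemLp g 2 ν) :
    ⟪hf.toLp f, hg.toLp g⟫_ℂ = ∫ x, g x * conj (f x) ∂ν := by
  rw [L2.inner_def]
  refine integral_congr_ae ?_
  filter_upwards [hf.coeFn_toLp, hg.coeFn_toLp] with x h1 h2
  rw [h1, h2, RCLike.inner_apply]

theorem eq_zero_of_inner_conj_orbitFunction (hR : IsEuclidean R) {b : R.Base} {θ : ι}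
    (hθ : IsHighestRoot b θ) (a : ι) (f : Lp ℂ 2 (domainMeasure b θ a))
    (h : ∀ l ∈ evenDominantWeights b a,
      ∫ x, f x * orbitFunction b l x ∂(domainMeasure b θ a) = 0) : f = 0 := by
  have := isFiniteMeasure_domainMeasure hR hθ a
  have := ae_eq_zero_of_integral_orbitFunction hR hθ a
    ((Lp.memLp f).integrable one_le_two) h
  exact (Lp.eq_zero_iff_ae_eq_zero).2 this

theorem isOrthogonalBasis_orbitFunction (hR : IsEuclidean R) {b : R.Base} {θ : ι}
    (hθ : IsHighestRoot b θ) (a : ι) :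
    IsOrthogonalBasis (fun l : evenDominantWeights b a =>
      (memLp_orbitFunction hR hθ a (l : E)).toLp (orbitFunction b (l : E))) := by
  have := isFiniteMeasure_domainMeasure hR hθ a
  constructor
  · intro l h0
    have h1 := inner_toLp (memLp_orbitFunction hR hθ a (l : E)) (memLp_orbitFunction hR hθ a (l : E))
    rw [h0, inner_zero_left, integral_orbitFunction_mul_conj hR hθ a l.2 l.2, if_pos rfl] at h1
    exact (stabCard_pos b (l : E)).ne' (by exact_mod_cast inv_eq_zero.1 h1.symm)
  · intro l m hlm
    rw [inner_toLp, integral_orbitFunction_mul_conj hR hθ a m.2 l.2,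
      if_neg fun h => hlm (Subtype.ext h.symm)]
  · refine topologicalClosure_span_eq_top_of_complete fun f hf => ?_
    -- The completeness lemma pairs without conjugation, whereas orthogonality to `E_l` involves its
    -- conjugate; the lemma is therefore applied to the conjugate of `f`.
    have hfc := memLp_conj (Lp.memLp f)
    have hz := ae_eq_zero_of_integral_orbitFunction hR hθ a (hfc.integrable one_le_two) (by
      intro l hl
      have h1 := hf ⟨l, hl⟩
      rw [← Lp.toLp_coeFn f (Lp.memLp f), inner_toLp] at h1
      have h2 := congrArg conj h1
      rw [← integral_conj, map_zero] at h2
      simpa only [map_mul, Complex.conj_conj] using h2)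
    refine (Lp.eq_zero_iff_ae_eq_zero).2 ?_
    filter_upwards [hz] with x hx
    exact (map_eq_zero _).1 hx

theorem integrable_mul_orbitFunction (b : R.Base) (l : E) {ν : Measure E} {f : E → ℂ}
    (hf : Integrable f ν) : Integrable (fun x => f x * orbitFunction b l x) ν :=
  hf.mul_bdd (continuous_orbitFunction b l).aestronglyMeasurable
    (Eventually.of_forall fun x => norm_orbitFunction_le b l x)

theorem transformCoeff_eq (b : R.Base) (θ a : ι) (f : E → ℂ) (l : E) :
    transformCoeff b θ a f l =
      ∫ x, f x * normalizedOrbitFunction b l x ∂(domainMeasure b θ a) := by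
  rw [transformCoeff, ← integral_const_mul]
  refine integral_congr_ae (Eventually.of_forall fun x => ?_)
  simp only [normalizedOrbitFunction_eq_stabCard_mul]
  ring

/-- Expansion of a square-integrable function in orbit functions. -/
theorem hasSum_transformCoeff (hR : IsEuclidean R) {b : R.Base} {θ : ι}
    (hθ : IsHighestRoot b θ) (a : ι) {f : E → ℂ} (hf : MemLp f 2 (domainMeasure b θ a)) :
    HasSum (fun l : evenDominantWeights b a => transformCoeff b θ a f l •
        (memLp_conj (memLp_orbitFunction hR hθ a (l : E))).toLp _) (hf.toLp f) ∧
      HasSum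
        (fun l : evenDominantWeights b a => (stabCard b l : ℝ)⁻¹ * ‖transformCoeff b θ a f l‖ ^ 2)
        (∫ x, ‖f x‖ ^ 2 ∂(domainMeasure b θ a)) := by
  have hpos : ∀ l : E, (0 : ℝ) < stabCard b l := fun l => by exact_mod_cast stabCard_pos b l
  -- The inner product is conjugate-linear on the left, so `c_l` is `|W_l|` times the product with
  -- the conjugate of `E_l`. This is why the expansion runs over conjugates and why Plancherel
  -- carries the weight `|W_l|⁻¹`.
  have hcoef : ∀ l : evenDominantWeights b a, transformCoeff b θ a f l =
      ((stabCard b (l : E) : ℝ) : ℂ) *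
        ⟪(memLp_conj (memLp_orbitFunction hR hθ a (l : E))).toLp _, hf.toLp f⟫_ℂ := fun l => by
    rw [inner_toLp]
    simp only [Complex.conj_conj, Complex.ofReal_natCast]
    rfl
  obtain ⟨h1, h2⟩ := hasSum_of_orthogonal_complete
    (v := fun l : evenDominantWeights b a =>
      (memLp_conj (memLp_orbitFunction hR hθ a (l : E))).toLp _)
    (r := fun l => (stabCard b (l : E) : ℝ)) (fun l => hpos l) (fun l => by
      rw [inner_toLp]
      simp_rw [Complex.conj_conj, mul_comm (conj _)]
      rw [integral_orbitFunction_mul_conj hR hθ a l.2 l.2, if_pos rfl, Complex.ofReal_natCast])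
    (fun l m hlm => by
      rw [inner_toLp]
      simp_rw [Complex.conj_conj, mul_comm (conj _)]
      rw [integral_orbitFunction_mul_conj hR hθ a l.2 m.2, if_neg fun h => hlm (Subtype.ext h)])
    (fun g hg => eq_zero_of_inner_conj_orbitFunction hR hθ a g fun l hl => by
      have h1 := hg ⟨l, hl⟩
      rw [← Lp.toLp_coeFn g (Lp.memLp g), inner_toLp] at h1
      simpa only [Complex.conj_conj] using h1)
    (hf.toLp f)
  refine ⟨by simpa only [hcoef] using h1, ?_⟩
  have hnorm : ‖hf.toLp f‖ ^ 2 = ∫ x, ‖f x‖ ^ 2 ∂(domainMeasure b θ a) := by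
    have h := inner_toLp hf hf
    rw [inner_self_eq_norm_sq_to_K] at h
    have hx : ∀ x, f x * conj (f x) = ((‖f x‖ ^ 2 : ℝ) : ℂ) := fun x => by
      rw [Complex.mul_conj, Complex.normSq_eq_norm_sq]
    simp_rw [hx] at h
    rw [integral_complex_ofReal] at h
    refine Complex.ofReal_injective (Eq.trans ?_ h)
    push_cast; rfl
  rw [← hnorm]
  convert h2 using 2 with l
  rw [hcoef l, norm_mul, Complex.norm_real, Real.norm_of_nonneg (hpos l).le]
  have := (hpos l).ne'
  field_simp

theorem tendsto_eLpNorm_sub_sum (hR : IsEuclidean R) {b : R.Base} {θ : ι}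
    (hθ : IsHighestRoot b θ) (a : ι) {f : E → ℂ} (hf : MemLp f 2 (domainMeasure b θ a)) :
    Tendsto
      (fun s : Finset (evenDominantWeights b a) =>
        eLpNorm (fun x => f x - ∑ l ∈ s, transformCoeff b θ a f l * conj (orbitFunction b l x)) 2
          (domainMeasure b θ a)) atTop (𝓝 0) := by
  have h := (hasSum_transformCoeff hR hθ a hf).1
  rw [HasSum, SummationFilter.unconditional_filter, Lp.tendsto_Lp_iff_tendsto_eLpNorm'] at h
  refine h.congr fun s => ?_
  rw [eLpNorm_sub_comm]
  refine eLpNorm_congr_ae ?_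
  -- A partial sum of `L²` classes agrees almost everywhere with the sum of functions, since only
  -- finitely many exceptional null sets occur.
  have h3 : ∀ᵐ x ∂(domainMeasure b θ a), ∀ l ∈ s,
      (transformCoeff b θ a f l •
        (memLp_conj (memLp_orbitFunction hR hθ a (l : E))).toLp _ : Lp ℂ 2 _) x =
      transformCoeff b θ a f l * conj (orbitFunction b l x) := by
    refine (eventually_all_finset s).2 fun l _ => ?_
    filter_upwards [Lp.coeFn_smul (transformCoeff b θ a f l)
      ((memLp_conj (memLp_orbitFunction hR hθ a (l : E))).toLp _),
      (memLp_conj (memLp_orbitFunction hR hθ a (l : E))).coeFn_toLp] with x h1 h2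
    rw [h1, Pi.smul_apply, h2, smul_eq_mul]
  filter_upwards [hf.coeFn_toLp, Lp.coeFn_finsetSum s (fun l : evenDominantWeights b a =>
    transformCoeff b θ a f l •
      (memLp_conj (memLp_orbitFunction hR hθ a (l : E))).toLp _), h3] with x h1 h2 h3
  rw [Pi.sub_apply, h1, h2, Finset.sum_apply, Finset.sum_congr rfl h3]

end

end EOrbit

open EOrbit in
theorem mainTheorem10 {ι E : Type*} [Finite ι]
    [NormedAddCommGroup E] [InnerProductSpace ℝ E] [FiniteDimensional ℝ E]
    [MeasurableSpace E] [BorelSpace E]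
    (R : RootPairing ι ℝ E E) [R.IsRootSystem] [R.IsCrystallographic] [R.IsReduced]
    [R.IsIrreducible] (hR : IsEuclidean R)
    (b : R.Base) (θ : ι) (hθ : IsHighestRoot b θ) (a : ι) :
    (∀ f : E → ℂ,
      (∀ g ∈ evenAffineWeylGroup b, ∀ x ∈ closure (evenAffineDomain b θ a),
        g x ∈ closure (evenAffineDomain b θ a) → f (g x) = f x) →
      MemLp f 2 (domainMeasure b θ a) →
      (∀ l ∈ evenDominantWeights b a,
        Integrable (fun x => f x * orbitFunction b l x) (domainMeasure b θ a) ∧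
        transformCoeff b θ a f l =
          ∫ x, f x * normalizedOrbitFunction b l x ∂(domainMeasure b θ a)) ∧
      Tendsto
        (fun s : Finset (evenDominantWeights b a) =>
          eLpNorm (fun x => f x - ∑ l ∈ s, transformCoeff b θ a f l * conj (orbitFunction b l x)) 2
            (domainMeasure b θ a))
        atTop (𝓝 0) ∧
      HasSum
        (fun l : evenDominantWeights b a => (stabCard b l : ℝ)⁻¹ * ‖transformCoeff b θ a f l‖ ^ 2)
        (∫ x, ‖f x‖ ^ 2 ∂(domainMeasure b θ a))) ∧
    ∃ hE : ∀ l : evenDominantWeights b a, MemLp (orbitFunction b (l : E)) 2 (domainMeasure b θ a),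
      IsOrthogonalBasis (fun l : evenDominantWeights b a => (hE l).toLp (orbitFunction b (l : E)))
        := by
  have := isFiniteMeasure_domainMeasure hR hθ a
  refine ⟨fun f _ hf => ⟨fun l _ => ⟨?_, transformCoeff_eq b θ a f l⟩, ?_, ?_⟩,
    fun l => memLp_orbitFunction hR hθ a l, isOrthogonalBasis_orbitFunction hR hθ a⟩
  · exact integrable_mul_orbitFunction b l (hf.integrable one_le_two)
  · exact tendsto_eLpNorm_sub_sum hR hθ a hf
  · exact (hasSum_transformCoeff hR hθ a hf).2
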